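/- **Setting.** Let $(S,A,P,R)$ be an MDP with horizon $T\ge 1$, initial state $s_0$, discrete transition probabilities $P(s,a,\cdot)$ and bounded rewards $R:S\to\mathbb R$. For $\pi:S\to A$ let $V_T^{(\pi)}=0$, $Q_t^{(\pi)}(s,a)=R(s)+\sum_{s'}P(s,a,s')V_{t+1}^{(\pi)}(s')$, $V_t^{(\pi)}(s)=Q_t^{(\pi)}(s,\pi(s))$, let $J(\pi)=-V_0^{(\pi)}(s_0)$, and let $d_t^{(\pi)}$ be the law of the state at time $t$ under $\pi$. Let $\pi^*:S\to A$ be an oracle, $\Pi=\{\pi_\theta:\theta\in\Theta\}$ a class of policies with $\Theta\subseteq\mathbb R^d$ convex, and $\tilde g(s,\theta)$ a function, convex in $\theta$, with $\tilde g(s,\theta)\ge\mathbb I[\pi_\theta(s)\ne\pi^*(s)]$. Put $\tilde\ell_t(s)=V_t^{(\pi^*)}(s)-\min_{a}Q_t^{(\pi^*)}(s,a)$ and $\tilde\ell_t(s,\pi_\theta)=\tilde\ell_t(s)\,\tilde g(s,\theta)$ (minima are read as infima), and let $\ell_{\max}$ be an upper bound on $\tilde\ell_t(s,\pi)$ for all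 $t<T$, $s\in S$, $\pi\in\Pi$. $Q$-DAgger runs for $N\ge1$ iterations. In iteration $i$ a learner outputs $\hat\pi_i\in\Pi$ as a function of the datasets collected before; then $m\ge1$ independent $T$-step trajectories are sampled with $\pi^*$ if $i=1$ and with $\hat\pi_i$ if $i\ge2$, and form the dataset of iteration $i$. The loss of a policy on a dataset is the average of $\tilde\ell_t(s_t,\pi)$ over its trajectories and over $t<T$. The training loss is $$\varepsilon_N=\min_{\pi\in\Pi}\frac1N\sum_{i=1}^N\frac1T\sum_{t=0}^{T-1}\mathbb E_{s\sim d_t^{(\hat\pi_i)}}\big[\tilde\ell_t(s,\pi)\big].$$ **Theorem.** Let $X=\ell_{\max}^2T^2\log(1/\delta)$. Fix $d$, $\delta_0<1$, and $c>0$, $k\in\mathbb N$. Suppose that one of the following holds. 1. The learner is a no-regret online learner: for every sequence of $N$ datasets, its average regret against $\Pi$ in the dataset losses is at most $\ell_{\max}\,r\,(1+\log(1+N))^{q}/\sqrt N$, for constants $r$ and $q$ (in particular this covers average regret $\ell_{\max}\tilde O(1/N)$). 2. The learner is follow-the-leader (it minimizes the loss on the aggregated dataset over $\Pi$), $\tilde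 g(s,\cdot)$ is $\kappa$-strongly convex and $G$-Lipschitz on $\Theta$ for all $s$, with constants $\kappa>0$ and $G$, and $\tilde\ell_t(s)\le\ell_{\max}$ for all $s$ and $t<T$. Then there are constants $C$ and $p$, which depend only on $d,\delta_0,c,k$ and on $r,q$ (in case 1) or $\kappa,G$ (in case 2), such that for all $\delta\in(0,\delta_0]$ and all $N$ with $N\ge X/\big(c\,(1+\log(1+X))^{k}\big)$ (that is, $N$ at least of order $\tilde\Theta(\ell_{\max}^2T^2\log(1/\delta))$), with probability at least $1-\delta$ there is a policy $\hat\pi\in\{\hat\pi_1,\dots,\hat\pi_N\}$ with $$J(\hat\pi)\le J(\pi^*)+T\varepsilon_N+C\,(1+\log(1+X))^{p},$$ i.e. $J(\hat\pi)\le J(\pi^*)+T\varepsilon_N+\tilde O(1)$. -/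

import Mathlib

noncomputable section

namespace QDagger

/-- The expectation `𝔼_{x ∼ p}[f x] = ∑ₓ p(x) f(x)` of a real function under a discrete
distribution. -/
def expect {α : Type*} (p : PMF α) (f : α → ℝ) : ℝ := ∑' x, (p x).toReal * f x

/-- The law of `n` independent samples from `p`. -/
def iid {α : Type*} (p : PMF α) : (n : ℕ) → PMF (Fin n → α)
  | 0 => PMF.pure Fin.elim0
  | n + 1 => p.bind fun x => (iid p n).map fun y => (Fin.cons x y : Fin (n + 1) → α)

/-- A finite-horizon Markov decision process with discrete transition probabilities, rewards on
states, and a single initial state. Rewards are bounded (automatic when `S` is finite), so that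
all the expectations below are convergent sums. -/
structure MDP (S A : Type*) where
  /-- the horizon -/
  T : ℕ
  T_pos : 0 < T
  /-- the initial state -/
  init : S
  /-- `P s a s'` is the probability of moving from `s` to `s'` under the action `a` -/
  P : S → A → PMF S
  /-- the reward -/
  R : S → ℝ
  R_bounded : ∃ B : ℝ, ∀ s, |R s| ≤ B

namespace MDP

variable {S A : Type*} (M : MDP S A)

/-- The value of a policy when `n` steps remain. -/
def valueToGo (π : S → A) : ℕ → S → ℝ
  | 0, _ => 0
  | n + 1, s => M.R s + expect (M.P s (π s)) (valueToGo π n)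

/-- The value function: `V_T = 0` and `V_t(s) = R(s) + ∑_{s'} P(s, π(s), s') V_{t+1}(s')`. -/
def V (π : S → A) (t : ℕ) (s : S) : ℝ := M.valueToGo π (M.T - t) s

/-- The `Q`-function: `Q_t(s, a) = R(s) + ∑_{s'} P(s, a, s') V_{t+1}(s')`. -/
def Q (π : S → A) (t : ℕ) (s : S) (a : A) : ℝ := M.R s + expect (M.P s a) (M.V π (t + 1))

/-- The distribution `d_t` of the state at time `t`. -/
def stateLaw (π : S → A) : ℕ → PMF S
  | 0 => PMF.pure M.init
  | t + 1 => (stateLaw π t).bind fun s => M.P s (π s)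

/-- The cost-to-go from the initial state. -/
def J (π : S → A) : ℝ := - M.V π 0 M.init

/-- The law of the first `n` states visited by `π` when it starts in a given state. -/
def pathLaw (π : S → A) : (n : ℕ) → S → PMF (Fin n → S)
  | 0, _ => PMF.pure Fin.elim0
  | n + 1, s => (M.P s (π s)).bind fun s' =>
      (pathLaw π n s').map fun x => (Fin.cons s x : Fin (n + 1) → S)

/-- The law of the `T`-step trajectory of `π` from the initial state. -/
def trajectoryLaw (π : S → A) : PMF (Fin M.T → S) := M.pathLaw π M.T M.init

/-- The weight `V_t^{π}(s) - min_a Q_t^{π}(s, a)` of the state `s` at time `t`. -/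
def weight (π : S → A) (t : ℕ) (s : S) : ℝ := M.V π t s - ⨅ a, M.Q π t s a

end MDP

open Classical in
/-- The 0-1 loss of a policy against the oracle in a state. -/
def zeroOne {S A : Type*} (oracle π : S → A) (s : S) : ℝ := if π s ≠ oracle s then 1 else 0

/-- The data of `Q`-DAgger: an MDP, an oracle policy, a class of policies with `d` real parameters
ranging over a convex set, and a surrogate for the 0-1 loss that is convex in the parameters and
bounds the 0-1 loss from above. -/
structure Problem (S A : Type*) (d : ℕ) extends MDP S A where
  oracle : S → A
  /-- the parameters of the policies in the class -/
  params : Set (EuclideanSpace ℝ (Fin d))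
  /-- the policy with given parameters -/
  policy : params → S → A
  /-- the surrogate loss in a state, as a function of the parameters -/
  surrogate : S → EuclideanSpace ℝ (Fin d) → ℝ
  surrogate_convex : ∀ s, ConvexOn ℝ params (surrogate s)
  zeroOne_le : ∀ (s : S) (θ : params), zeroOne oracle (policy θ) s ≤ surrogate s θ

namespace Problem

variable {S A : Type*} {d : ℕ} (I : Problem S A d)

/-- The convex loss `(V_t^{π*}(s) - min_a Q_t^{π*}(s, a)) g̃(s, π_θ)`. -/
def loss (t : ℕ) (s : S) (θ : I.params) : ℝ :=
  I.toMDP.weight I.oracle t s * I.surrogate s θ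

/-- `b` is an upper bound on the convex loss. -/
def IsLossBound (b : ℝ) : Prop := ∀ t < I.T, ∀ (s : S) (θ : I.params), I.loss t s θ ≤ b

/-- A dataset: `m` trajectories of `T` states. The labels are the oracle's actions in these
states, hence are determined by the states. -/
abbrev Dataset (m : ℕ) : Type _ := Fin m → Fin I.T → S

/-- The average convex loss on a dataset. -/
def empLoss {m : ℕ} (D : I.Dataset m) (θ : I.params) : ℝ :=
  (m : ℝ)⁻¹ * ∑ j, (I.T : ℝ)⁻¹ * ∑ t : Fin I.T, I.loss t (D j t) θ

/-- The expected convex loss of `π_θ` on the states visited by `π`, averaged over time. -/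
def expLoss (π : S → A) (θ : I.params) : ℝ :=
  (I.T : ℝ)⁻¹ * ∑ t : Fin I.T, expect (I.toMDP.stateLaw π t) fun s => I.loss t s θ

/-- An online learner: it trains the next policy of the class on the datasets collected so far. -/
abbrev Learner (m : ℕ) : Type _ := (n : ℕ) → (Fin n → I.Dataset m) → I.params

variable {I} {m : ℕ}

namespace Learner

/-- The parameters of the policy trained before iteration `i` (counted from `0`), when the datasets
collected in all the iterations are `D`. -/
def iterate (L : I.Learner m) {N : ℕ} (D : Fin N → I.Dataset m) (i : Fin N) : I.params :=
  L i fun j => D (Fin.castLE i.isLt.le j)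

/-- The policy that collects the data of iteration `n` (counted from `0`) after the datasets `D`:
the oracle in the first iteration, the current trained policy in every later one. -/
def rollout (L : I.Learner m) (n : ℕ) (D : Fin n → I.Dataset m) : S → A :=
  if n = 0 then I.oracle else I.policy (L n D)

/-- The law of the datasets collected in `n` iterations of `Q`-DAgger with `m` trajectories in each
iteration. -/
def run (L : I.Learner m) : (n : ℕ) → PMF (Fin n → I.Dataset m)
  | 0 => PMF.pure Fin.elim0
  | n + 1 => (run L n).bind fun D =>
      (iid (I.toMDP.trajectoryLaw (L.rollout n D)) m).map fun D' =>
        (Fin.snoc D D' : Fin (n + 1) → I.Dataset m)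

/-- The training loss `ε_N`: the least convex loss in the class, on the states visited by the
policies of all the iterations. -/
def trainingLoss (L : I.Learner m) {N : ℕ} (D : Fin N → I.Dataset m) : ℝ :=
  ⨅ θ : I.params, (N : ℝ)⁻¹ * ∑ i, I.expLoss (I.policy (L.iterate D i)) θ

/-- The average regret of the learner over `N` rounds is at most `γ`, for all datasets. -/
def RegretLE (L : I.Learner m) (N : ℕ) (γ : ℝ) : Prop :=
  ∀ (D : Fin N → I.Dataset m) (θ : I.params),
    (N : ℝ)⁻¹ * ∑ i, I.empLoss (D i) (L.iterate D i) ≤ (N : ℝ)⁻¹ * ∑ i, I.empLoss (D i) θ + γ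

/-- The learner is follow-the-leader: it minimizes the loss on the aggregated dataset. -/
def IsFollowTheLeader (L : I.Learner m) : Prop :=
  ∀ (n : ℕ) (D : Fin n → I.Dataset m) (θ : I.params),
    ∑ i, I.empLoss (D i) (L n D) ≤ ∑ i, I.empLoss (D i) θ

/-- The probability that one of the policies `π̂` of the `N` iterations satisfies
`J(π̂) ≤ J(π*) + T ε_N + e`. -/
def successProb (L : I.Learner m) (N : ℕ) (e : ℝ) : ENNReal :=
  (L.run N).toOuterMeasure {D | ∃ i : Fin N,
    I.toMDP.J (I.policy (L.iterate D i)) ≤ I.toMDP.J I.oracle + I.T * L.trainingLoss D + e}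

end Learner

end Problem

/-- The order `ℓ_max² T² log(1/δ)` of the number of iterations. -/
def order (b : ℝ) (T : ℕ) (δ : ℝ) : ℝ := b ^ 2 * (T : ℝ) ^ 2 * Real.log (1 / δ)

/-- A polylogarithmic factor `c (1 + log (1 + x)) ^ k`. -/
def polylog (c : ℝ) (k : ℕ) (x : ℝ) : ℝ := c * (1 + Real.log (1 + x)) ^ k

end QDagger

end

namespace QDagger

open scoped ENNReal

/-! By the performance difference lemma, the excess cost of a policy over the oracle is a sum over
time of expected oracle disadvantages on the policy's own states. The surrogate loss dominates each
of them (`J_le`), so the best iterate has excess at most `T` times the average on-policy loss of the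
iterates. That average has to be compared with the training loss.

An iterate depends only on earlier datasets, so the Azuma-Hoeffding inequality
(`toOuterMeasure_deviation_le`) passes from its expected to its empirical losses, and small regret
then replaces the iterates by a comparator. The difficulty is that the minimizer behind the training
loss depends on all the data, so deviations are needed uniformly over comparators, while the
surrogate is merely convex and the parameter set may be unbounded. A metric cover is not available.

Convexity replaces it. The law of the datasets is discrete, so up to probability `δ / 2` only
finitely many near-minimizers matter. By `exists_convex_net` each of them can be moved a fraction `1
/ N` towards another point of the class so as to land in a set of about `N ^ d` points, fixed before
the data are seen. Losses lie in `[0, b]`, so the move costs at most `b / N` per round, and the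
union bound adds only about `d log N` to the exponent (`le_successProb`).

The excess is thus `√(X / N)` up to logarithms of `N`, and these become logarithms of `X` once `N`
is of order `X` (`mul_one_add_log_pow_div_le`). Follow-the-leader reduces to this general case
through its logarithmic regret (`IsFollowTheLeader.regretLE`). -/

/-- The expectation of a nonnegative extended real function under a discrete distribution. -/
noncomputable def lexpect {α : Type*} (p : PMF α) (f : α → ℝ≥0∞) : ℝ≥0∞ := ∑' x, p x * f x

/-! ### Expectations under discrete distributions. -/

section Expectation

variable {α β : Type*}

lemma lexpect_pure (a : α) (f : α → ℝ≥0∞) : lexpect (PMF.pure a) f = f a := by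
  unfold lexpect
  rw [tsum_eq_single a]
  · simp
  · intro b hb
    simp [PMF.pure_apply, hb]

lemma lexpect_bind (p : PMF α) (q : α → PMF β) (f : β → ℝ≥0∞) :
    lexpect (p.bind q) f = lexpect p fun x => lexpect (q x) f := by
  simp only [lexpect, PMF.bind_apply, ← ENNReal.tsum_mul_right, ← ENNReal.tsum_mul_left]
  rw [ENNReal.tsum_comm]
  simp only [mul_assoc]

lemma lexpect_map (p : PMF α) (g : α → β) (f : β → ℝ≥0∞) :
    lexpect (p.map g) f = lexpect p fun x => f (g x) := by
  rw [← PMF.bind_pure_comp, lexpect_bind]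
  simp only [Function.comp_apply, lexpect_pure]

lemma lexpect_mono (p : PMF α) {f g : α → ℝ≥0∞} (h : ∀ x, f x ≤ g x) :
    lexpect p f ≤ lexpect p g :=
  ENNReal.tsum_le_tsum fun x => mul_le_mul_right (h x) _

lemma lexpect_const (p : PMF α) (c : ℝ≥0∞) : lexpect p (fun _ => c) = c := by
  simp [lexpect, ENNReal.tsum_mul_right]

lemma lexpect_const_mul (p : PMF α) (c : ℝ≥0∞) (f : α → ℝ≥0∞) :
    lexpect p (fun x => c * f x) = c * lexpect p f := by
  simp only [lexpect, ← ENNReal.tsum_mul_left]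
  exact tsum_congr fun x => by ring

/-- Markov's inequality. -/
lemma toOuterMeasure_le_lexpect (p : PMF α) (f : α → ℝ≥0∞) :
    p.toOuterMeasure {x | 1 ≤ f x} ≤ lexpect p f := by
  rw [PMF.toOuterMeasure_apply]
  refine ENNReal.tsum_le_tsum fun x => ?_
  by_cases hx : 1 ≤ f x
  · rw [Set.indicator_of_mem (by exact hx)]
    exact le_mul_of_one_le_right bot_le hx
  · rw [Set.indicator_of_notMem (by exact hx)]
    exact bot_le

lemma summable_expect (p : PMF α) {f : α → ℝ} (hf : ∃ B, ∀ x, |f x| ≤ B) :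
    Summable fun x => (p x).toReal * f x := by
  obtain ⟨B, hB⟩ := hf
  refine Summable.of_norm_bounded
    ((ENNReal.summable_toReal p.tsum_coe_ne_top).mul_right B) fun x => ?_
  rw [norm_mul, Real.norm_eq_abs, Real.norm_eq_abs, abs_of_nonneg ENNReal.toReal_nonneg]
  exact mul_le_mul_of_nonneg_left (hB x) ENNReal.toReal_nonneg

lemma tsum_toReal_eq_one (p : PMF α) : ∑' x, (p x).toReal = 1 := by
  rw [← ENNReal.tsum_toReal_eq p.apply_ne_top, p.tsum_coe, ENNReal.toReal_one]

lemma expect_const (p : PMF α) (c : ℝ) : expect p (fun _ => c) = c := by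
  simp [expect, tsum_mul_right, tsum_toReal_eq_one]

lemma expect_add (p : PMF α) {f g : α → ℝ} (hf : ∃ B, ∀ x, |f x| ≤ B)
    (hg : ∃ B, ∀ x, |g x| ≤ B) :
    expect p (fun x => f x + g x) = expect p f + expect p g := by
  simp only [expect, mul_add]
  exact (summable_expect p hf).tsum_add (summable_expect p hg)

lemma expect_sub (p : PMF α) {f g : α → ℝ} (hf : ∃ B, ∀ x, |f x| ≤ B)
    (hg : ∃ B, ∀ x, |g x| ≤ B) :
    expect p (fun x => f x - g x) = expect p f - expect p g := by
  simp only [expect, mul_sub]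
  exact (summable_expect p hf).tsum_sub (summable_expect p hg)

lemma expect_const_mul (p : PMF α) (c : ℝ) (f : α → ℝ) :
    expect p (fun x => c * f x) = c * expect p f := by
  simp only [expect, ← tsum_mul_left]
  exact tsum_congr fun x => by ring

lemma expect_sum (p : PMF α) {ι : Type*} (s : Finset ι) {f : ι → α → ℝ}
    (hf : ∀ i ∈ s, ∃ B, ∀ x, |f i x| ≤ B) :
    expect p (fun x => ∑ i ∈ s, f i x) = ∑ i ∈ s, expect p (f i) := by
  simp only [expect, Finset.mul_sum]
  exact Summable.tsum_finsetSum fun i hi => summable_expect p (hf i hi)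

lemma expect_mono (p : PMF α) {f g : α → ℝ} (hf : ∃ B, ∀ x, |f x| ≤ B)
    (hg : ∃ B, ∀ x, |g x| ≤ B) (h : ∀ x, f x ≤ g x) : expect p f ≤ expect p g :=
  (summable_expect p hf).tsum_le_tsum
    (fun x => mul_le_mul_of_nonneg_left (h x) ENNReal.toReal_nonneg) (summable_expect p hg)

lemma expect_nonneg (p : PMF α) {f : α → ℝ} (h : ∀ x, 0 ≤ f x) : 0 ≤ expect p f :=
  tsum_nonneg fun x => mul_nonneg ENNReal.toReal_nonneg (h x)

lemma exists_abs_le_of_nonneg_of_le {f : α → ℝ} {B : ℝ} (h0 : ∀ x, 0 ≤ f x) (hB : ∀ x, f x ≤ B) :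
    ∃ B, ∀ x, |f x| ≤ B :=
  ⟨B, fun x => by rw [abs_of_nonneg (h0 x)]; exact hB x⟩

lemma expect_le (p : PMF α) {f : α → ℝ} {B : ℝ} (h0 : ∀ x, 0 ≤ f x) (hB : ∀ x, f x ≤ B) :
    expect p f ≤ B := by
  have hf : ∃ B, ∀ x, |f x| ≤ B := exists_abs_le_of_nonneg_of_le h0 hB
  calc expect p f ≤ expect p (fun _ => B) := expect_mono p hf ⟨|B|, fun _ => le_rfl⟩ hB
    _ = B := expect_const p B

lemma abs_expect_le (p : PMF α) {f : α → ℝ} {B : ℝ} (hB : ∀ x, |f x| ≤ B) :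
    |expect p f| ≤ B := by
  rw [abs_le]
  have h1 := expect_mono p ⟨B, hB⟩ ⟨|B|, fun _ => le_rfl⟩ (fun x => (abs_le.1 (hB x)).2)
  have h2 := expect_mono p ⟨|-B|, fun _ => le_rfl⟩ ⟨B, hB⟩ (fun x => (abs_le.1 (hB x)).1)
  rw [expect_const] at h1 h2
  exact ⟨h2, h1⟩

lemma expect_pure (a : α) (f : α → ℝ) : expect (PMF.pure a) f = f a := by
  unfold expect
  rw [tsum_eq_single a]
  · simp
  · intro b hb
    simp [PMF.pure_apply, hb]

lemma expect_eq_toReal_lexpect (p : PMF α) {f : α → ℝ} (h0 : ∀ x, 0 ≤ f x) :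
    expect p f = (lexpect p fun x => ENNReal.ofReal (f x)).toReal := by
  unfold expect lexpect
  rw [ENNReal.tsum_toReal_eq fun x => ENNReal.mul_ne_top (p.apply_ne_top x) ENNReal.ofReal_ne_top]
  exact tsum_congr fun x => by rw [ENNReal.toReal_mul, ENNReal.toReal_ofReal (h0 x)]

lemma ofReal_expect (p : PMF α) {f : α → ℝ} (h0 : ∀ x, 0 ≤ f x) (hf : ∃ B, ∀ x, |f x| ≤ B) :
    ENNReal.ofReal (expect p f) = lexpect p fun x => ENNReal.ofReal (f x) := by
  rw [expect_eq_toReal_lexpect p h0, ENNReal.ofReal_toReal]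
  obtain ⟨B, hB⟩ := hf
  refine ne_top_of_le_ne_top (b := ENNReal.ofReal B) ENNReal.ofReal_ne_top ?_
  rw [← lexpect_const p (ENNReal.ofReal B)]
  exact lexpect_mono p fun x => ENNReal.ofReal_le_ofReal ((le_abs_self _).trans (hB x))

lemma expect_bind (p : PMF α) (q : α → PMF β) {f : β → ℝ} (hf : ∃ B, ∀ x, |f x| ≤ B) :
    expect (p.bind q) f = expect p fun x => expect (q x) f := by
  obtain ⟨B, hB⟩ := hf
  have key : ∀ g : β → ℝ, (∀ x, 0 ≤ g x) → (∃ B, ∀ x, |g x| ≤ B) →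
      expect (p.bind q) g = expect p fun x => expect (q x) g := by
    intro g h0 hg
    rw [expect_eq_toReal_lexpect _ h0, expect_eq_toReal_lexpect _ fun x => expect_nonneg _ h0,
      lexpect_bind]
    simp only [ofReal_expect _ h0 hg]
  have hc : ∃ C : ℝ, ∀ _ : β, |B| ≤ C := ⟨|B|, fun _ => le_rfl⟩
  -- Shifting by the bound `B` makes the function nonnegative, where sums may be interchanged freely
  -- in `ℝ≥0∞`; the constant then cancels.
  have h := key (fun x => f x + B) (fun x => by linarith [(abs_le.1 (hB x)).1])
    ⟨B + |B|, fun x => (abs_add_le _ _).trans (by linarith [hB x])⟩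
  rw [expect_add _ ⟨B, hB⟩ hc, expect_const] at h
  simp only [expect_add _ ⟨B, hB⟩ hc, expect_const] at h
  rw [expect_add p ⟨B, fun x => abs_expect_le _ hB⟩ ⟨|B|, fun _ => le_rfl⟩, expect_const] at h
  linarith

lemma expect_map (p : PMF α) (g : α → β) (f : β → ℝ) (hf : ∃ B, ∀ x, |f x| ≤ B) :
    expect (p.map g) f = expect p fun x => f (g x) := by
  rw [← PMF.bind_pure_comp, expect_bind _ _ hf]
  simp only [Function.comp_apply, expect_pure]

lemma iid_map_apply (p : PMF α) : ∀ (n : ℕ) (j : Fin n), (iid p n).map (fun x => x j) = p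
  | 0, j => j.elim0
  | n + 1, j => by
    rw [iid, PMF.map_bind]
    simp only [PMF.map_comp]
    induction j using Fin.cases with
    | zero =>
      have : ∀ x : α, ((fun y : Fin (n + 1) → α => y 0) ∘ fun y : Fin n → α =>
          (Fin.cons x y : Fin (n + 1) → α)) = Function.const _ x := by
        intro x; ext y; simp
      simp only [this, PMF.map_const, PMF.bind_pure]
    | succ j =>
      have : ∀ x : α, ((fun y : Fin (n + 1) → α => y j.succ) ∘ fun y : Fin n → α =>
          (Fin.cons x y : Fin (n + 1) → α)) = fun y => y j := by
        intro x; ext y; simp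
      simp only [this, iid_map_apply p n j, PMF.bind_const]

end Expectation

/-! ### Performance difference lemma and time marginals of trajectories. -/

namespace MDP

variable {S A : Type*} (M : MDP S A)

lemma valueToGo_bounded (π : S → A) (n : ℕ) : ∃ B, ∀ s, |M.valueToGo π n s| ≤ B := by
  obtain ⟨B, hB⟩ := M.R_bounded
  induction n with
  | zero => exact ⟨0, fun s => by simp [valueToGo]⟩
  | succ n ih =>
    obtain ⟨C, hC⟩ := ih
    refine ⟨B + C, fun s => ?_⟩
    rw [valueToGo]
    exact (abs_add_le _ _).trans (add_le_add (hB s) (abs_expect_le _ hC))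

lemma V_bounded (π : S → A) (t : ℕ) : ∃ B, ∀ s, |M.V π t s| ≤ B := M.valueToGo_bounded π _

lemma Q_bounded (π : S → A) (t : ℕ) : ∃ B, ∀ s a, |M.Q π t s a| ≤ B := by
  obtain ⟨B, hB⟩ := M.R_bounded
  obtain ⟨C, hC⟩ := M.V_bounded π (t + 1)
  exact ⟨B + C, fun s a => (abs_add_le _ _).trans (add_le_add (hB s) (abs_expect_le _ hC))⟩

lemma V_eq_Q (π : S → A) {t : ℕ} (ht : t < M.T) (s : S) : M.V π t s = M.Q π t s (π s) := by
  have : M.T - t = (M.T - (t + 1)) + 1 := by omega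
  rw [V, this, valueToGo, Q]
  rfl

lemma bddBelow_Q (π : S → A) (t : ℕ) (s : S) : BddBelow (Set.range (M.Q π t s)) := by
  obtain ⟨B, hB⟩ := M.Q_bounded π t
  exact ⟨-B, by rintro _ ⟨a, rfl⟩; exact (abs_le.1 (hB s a)).1⟩

lemma sub_Q_le_weight (π : S → A) (t : ℕ) (s : S) (a : A) :
    M.V π t s - M.Q π t s a ≤ M.weight π t s :=
  sub_le_sub_left (ciInf_le (M.bddBelow_Q π t s) a) _

lemma weight_nonneg (π : S → A) {t : ℕ} (ht : t < M.T) (s : S) : 0 ≤ M.weight π t s := by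
  have := M.sub_Q_le_weight π t s (π s)
  rwa [M.V_eq_Q π ht, sub_self] at this

/-- The performance difference lemma, from time `t` on. -/
lemma sum_expect_advantage (π ρ : S → A) (n : ℕ) (hn : n ≤ M.T) :
    expect (M.stateLaw ρ n) (fun s => M.V π n s - M.V ρ n s) +
      ∑ t ∈ Finset.range n, expect (M.stateLaw ρ t) (fun s => M.V π t s - M.Q π t s (ρ s)) =
    M.V π 0 M.init - M.V ρ 0 M.init := by
  induction n with
  | zero => simp [stateLaw, expect_pure]
  | succ n ih =>
    rw [← ih (by omega), Finset.sum_range_succ]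
    have hV : ∀ (σ : S → A) (t : ℕ), ∃ B, ∀ s, |M.V σ t s| ≤ B := M.V_bounded
    have hQ : ∃ B, ∀ s, |M.Q π n s (ρ s)| ≤ B := by
      obtain ⟨B, hB⟩ := M.Q_bounded π n
      exact ⟨B, fun s => hB s _⟩
    have hVV : ∃ B, ∀ s, |M.V π (n + 1) s - M.V ρ (n + 1) s| ≤ B := by
      obtain ⟨B, hB⟩ := hV π (n + 1)
      obtain ⟨C, hC⟩ := hV ρ (n + 1)
      exact ⟨B + C, fun s => (abs_sub _ _).trans (add_le_add (hB s) (hC s))⟩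
    -- One Bellman step: both `Q`-functions are taken at the action of `ρ`, so the rewards cancel in
    -- their difference, and `ρ`'s own `Q`-value is its value.
    have h1 : expect (M.stateLaw ρ (n + 1)) (fun s => M.V π (n + 1) s - M.V ρ (n + 1) s) =
        expect (M.stateLaw ρ n) (fun s => M.Q π n s (ρ s) - M.V ρ n s) := by
      rw [stateLaw, expect_bind _ _ hVV]
      congr 1
      ext s
      rw [expect_sub _ (hV π _) (hV ρ _), M.V_eq_Q ρ (by omega : n < M.T), Q, Q]
      ring
    rw [h1, expect_sub _ hQ (hV ρ n), expect_sub _ (hV π n) hQ, expect_sub _ (hV π n) (hV ρ n)]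
    ring

lemma J_sub_J (π ρ : S → A) :
    M.J ρ - M.J π = ∑ t ∈ Finset.range M.T,
      expect (M.stateLaw ρ t) (fun s => M.V π t s - M.Q π t s (ρ s)) := by
  have h := M.sum_expect_advantage π ρ M.T le_rfl
  have h0 : ∀ σ : S → A, ∀ s, M.V σ M.T s = 0 := fun σ s => by simp [V, valueToGo]
  simp only [h0, sub_zero, expect_const, zero_add] at h
  rw [h, J, J]
  ring

/-- The law of the state at time `t` when the chain starts in `s`. -/
noncomputable def stateLawFrom (π : S → A) : ℕ → S → PMF S
  | 0, s => PMF.pure s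
  | t + 1, s => (M.P s (π s)).bind fun s' => stateLawFrom π t s'

/-- `pathLaw` unrolls the chain at its first step and `stateLaw` at its last; this exchange of the
two recursions connects them. -/
lemma stateLawFrom_succ (π : S → A) (t : ℕ) (s : S) :
    M.stateLawFrom π (t + 1) s = (M.stateLawFrom π t s).bind fun s => M.P s (π s) := by
  induction t generalizing s with
  | zero => simp [stateLawFrom]
  | succ t ih =>
    conv_rhs => rw [stateLawFrom, PMF.bind_bind]
    rw [stateLawFrom]
    simp only [ih]

lemma stateLawFrom_init (π : S → A) (t : ℕ) : M.stateLawFrom π t M.init = M.stateLaw π t := by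
  induction t with
  | zero => rfl
  | succ t ih => rw [stateLawFrom_succ, ih, stateLaw]

lemma pathLaw_map_apply (π : S → A) : ∀ (n : ℕ) (t : Fin n) (s : S),
    (M.pathLaw π n s).map (fun x => x t) = M.stateLawFrom π t s
  | 0, t, _ => t.elim0
  | n + 1, t, s => by
    rw [pathLaw, PMF.map_bind]
    simp only [PMF.map_comp]
    induction t using Fin.cases with
    | zero =>
      have : ((fun y : Fin (n + 1) → S => y 0) ∘ fun y : Fin n → S =>
          (Fin.cons s y : Fin (n + 1) → S)) = Function.const _ s := by
        ext y; simp
      simp only [this, PMF.map_const, PMF.bind_const]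
      rfl
    | succ t =>
      have : ((fun y : Fin (n + 1) → S => y t.succ) ∘ fun y : Fin n → S =>
          (Fin.cons s y : Fin (n + 1) → S)) = fun y => y t := by
        ext y; simp
      simp only [this, pathLaw_map_apply π n t]
      rfl

lemma trajectoryLaw_map_apply (π : S → A) (t : Fin M.T) :
    (M.trajectoryLaw π).map (fun x => x t) = M.stateLaw π t := by
  rw [trajectoryLaw, pathLaw_map_apply, stateLawFrom_init]

end MDP

/-! ### Bounds, convexity and unbiasedness of the losses. -/

namespace Problem

variable {S A : Type*} {d : ℕ} (I : Problem S A d)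

lemma surrogate_nonneg (s : S) (θ : I.params) : 0 ≤ I.surrogate s θ := by
  refine le_trans ?_ (I.zeroOne_le s θ)
  unfold zeroOne
  split_ifs <;> norm_num

lemma loss_nonneg {t : ℕ} (ht : t < I.T) (s : S) (θ : I.params) : 0 ≤ I.loss t s θ :=
  mul_nonneg (I.toMDP.weight_nonneg _ ht s) (I.surrogate_nonneg s θ)

lemma loss_convex {t : ℕ} (ht : t < I.T) (s : S) {x y z : I.params} {a c : ℝ} (ha : 0 ≤ a)
    (hc : 0 ≤ c) (hac : a + c = 1) (hz : z.1 = a • x.1 + c • y.1) :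
    I.loss t s z ≤ a * I.loss t s x + c * I.loss t s y := by
  have h := (I.surrogate_convex s).2 x.2 y.2 ha hc hac
  rw [← hz, smul_eq_mul, smul_eq_mul] at h
  have := mul_le_mul_of_nonneg_left h (I.toMDP.weight_nonneg I.oracle ht s)
  unfold loss
  linarith

variable {I} {b : ℝ} {m : ℕ}

namespace IsLossBound

lemma loss_bounded (hb : I.IsLossBound b) {t : ℕ} (ht : t < I.T) (θ : I.params) :
    ∃ B, ∀ s, |I.loss t s θ| ≤ B :=
  exists_abs_le_of_nonneg_of_le (fun s => I.loss_nonneg ht s θ) fun s => hb t ht s θ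

/-- Where the policy agrees with the oracle the disadvantage vanishes. Elsewhere it is at most the
weight, and the surrogate is at least `1`. -/
lemma J_le (hb : I.IsLossBound b) (θ : I.params) :
    I.toMDP.J (I.policy θ) ≤ I.toMDP.J I.oracle + I.T * I.expLoss (I.policy θ) θ := by
  have hT : (I.T : ℝ) ≠ 0 := by exact_mod_cast I.T_pos.ne'
  have h := I.toMDP.J_sub_J I.oracle (I.policy θ)
  rw [expLoss, mul_inv_cancel_left₀ hT]
  rw [← Fin.sum_univ_eq_sum_range
    (fun t => expect (I.toMDP.stateLaw (I.policy θ) t) (fun s => I.toMDP.V I.oracle t s -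
      I.toMDP.Q I.oracle t s (I.policy θ s)))] at h
  have key : ∑ t : Fin I.T, expect (I.toMDP.stateLaw (I.policy θ) t)
      (fun s => I.toMDP.V I.oracle t s - I.toMDP.Q I.oracle t s (I.policy θ s)) ≤
      ∑ t : Fin I.T, expect (I.toMDP.stateLaw (I.policy θ) t) (fun s => I.loss t s θ) := by
    refine Finset.sum_le_sum fun t _ => expect_mono _ ?_ (hb.loss_bounded t.2 θ) fun s => ?_
    · obtain ⟨B, hB⟩ := I.toMDP.V_bounded I.oracle t
      obtain ⟨C, hC⟩ := I.toMDP.Q_bounded I.oracle t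
      exact ⟨B + C, fun s => (abs_sub _ _).trans (add_le_add (hB s) (hC s _))⟩
    · by_cases hs : I.policy θ s = I.oracle s
      · rw [hs, I.toMDP.V_eq_Q _ t.2, sub_self]
        exact I.loss_nonneg t.2 s θ
      · have h1 : 1 ≤ I.surrogate s θ := by
          have := I.zeroOne_le s θ
          rwa [zeroOne, if_pos hs] at this
        exact (I.toMDP.sub_Q_le_weight I.oracle t s _).trans
          (le_mul_of_one_le_right (I.toMDP.weight_nonneg _ t.2 s) h1)
  linarith

lemma average_time_le {f : Fin I.T → ℝ} (hf : ∀ t, f t ≤ b) : (I.T : ℝ)⁻¹ * ∑ t, f t ≤ b := by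
  have hT : (0 : ℝ) < I.T := by exact_mod_cast I.T_pos
  rw [inv_mul_le_iff₀ hT]
  calc ∑ t, f t ≤ ∑ _t : Fin I.T, b := Finset.sum_le_sum fun t _ => hf t
    _ = I.T * b := by simp

lemma expLoss_le (hb : I.IsLossBound b) (π : S → A) (θ : I.params) : I.expLoss π θ ≤ b :=
  average_time_le fun t => expect_le _ (fun s => I.loss_nonneg t.2 s θ) fun s => hb t t.2 s θ

lemma empLoss_le (hb : I.IsLossBound b) (hm : 0 < m) (D : I.Dataset m) (θ : I.params) :
    I.empLoss D θ ≤ b := by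
  have hm' : (0 : ℝ) < m := by exact_mod_cast hm
  rw [empLoss, inv_mul_le_iff₀ hm']
  calc _ ≤ ∑ _j : Fin m, b :=
        Finset.sum_le_sum fun j _ => average_time_le fun t => hb t t.2 (D j t) θ
    _ = m * b := by simp

end IsLossBound

lemma expLoss_nonneg (π : S → A) (θ : I.params) : 0 ≤ I.expLoss π θ :=
  mul_nonneg (by positivity) (Finset.sum_nonneg fun t _ =>
    expect_nonneg _ fun s => I.loss_nonneg t.2 s θ)

lemma empLoss_nonneg (D : I.Dataset m) (θ : I.params) : 0 ≤ I.empLoss D θ :=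
  mul_nonneg (by positivity) (Finset.sum_nonneg fun j _ => mul_nonneg (by positivity)
    (Finset.sum_nonneg fun t _ => I.loss_nonneg t.2 _ θ))

lemma IsLossBound.nonneg (hb : I.IsLossBound b) (θ : I.params) : 0 ≤ b :=
  (I.loss_nonneg I.T_pos I.init θ).trans (hb 0 I.T_pos I.init θ)

lemma IsLossBound.expLoss_convex (hb : I.IsLossBound b) (π : S → A) {x y z : I.params} {a c : ℝ}
    (ha : 0 ≤ a) (hc : 0 ≤ c) (hac : a + c = 1)
    (hz : z.1 = a • x.1 + c • y.1) :
    I.expLoss π z ≤ a * I.expLoss π x + c * I.expLoss π y := by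
  have hmul : ∀ (k : ℝ) {f : S → ℝ}, (∃ B, ∀ s, |f s| ≤ B) → ∃ B, ∀ s, |k * f s| ≤ B := by
    rintro k f ⟨B, hB⟩
    exact ⟨|k| * B, fun s => by
      rw [abs_mul]; exact mul_le_mul_of_nonneg_left (hB s) (abs_nonneg k)⟩
  have hadd : ∀ {f g : S → ℝ}, (∃ B, ∀ s, |f s| ≤ B) → (∃ B, ∀ s, |g s| ≤ B) →
      ∃ B, ∀ s, |f s + g s| ≤ B := by
    rintro f g ⟨B, hB⟩ ⟨C, hC⟩
    exact ⟨B + C, fun s => (abs_add_le _ _).trans (add_le_add (hB s) (hC s))⟩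
  have h : ∑ t : Fin I.T, expect (I.toMDP.stateLaw π t) (fun s => I.loss t s z) ≤
      ∑ t : Fin I.T, (a * expect (I.toMDP.stateLaw π t) (fun s => I.loss t s x) +
        c * expect (I.toMDP.stateLaw π t) (fun s => I.loss t s y)) := by
    refine Finset.sum_le_sum fun t _ => ?_
    rw [← expect_const_mul, ← expect_const_mul,
      ← expect_add _ (hmul a (hb.loss_bounded t.2 x)) (hmul c (hb.loss_bounded t.2 y))]
    exact expect_mono _ (hb.loss_bounded t.2 z)
      (hadd (hmul a (hb.loss_bounded t.2 x)) (hmul c (hb.loss_bounded t.2 y)))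
      fun s => I.loss_convex t.2 s ha hc hac hz
  have := mul_le_mul_of_nonneg_left h (by positivity : 0 ≤ (I.T : ℝ)⁻¹)
  rw [Finset.sum_add_distrib, ← Finset.mul_sum, ← Finset.mul_sum] at this
  unfold expLoss
  linarith

/-- By linearity only the one-time marginals of a single trajectory enter, so the dependence between
the states of a trajectory is harmless. -/
lemma IsLossBound.expect_empLoss (hb : I.IsLossBound b) (hm : 0 < m) (π : S → A) (θ : I.params) :
    expect (iid (I.toMDP.trajectoryLaw π) m) (fun D => I.empLoss D θ) = I.expLoss π θ := by
  have hm' : (m : ℝ) ≠ 0 := by exact_mod_cast hm.ne'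
  have hbd : ∀ (t : Fin I.T) (j : Fin m), ∃ B, ∀ D : Fin m → Fin I.T → S,
      |I.loss t (D j t) θ| ≤ B := fun t j => by
    obtain ⟨B, hB⟩ := hb.loss_bounded t.2 θ
    exact ⟨B, fun D => hB _⟩
  have h1 : ∀ (t : Fin I.T) (j : Fin m), expect (iid (I.toMDP.trajectoryLaw π) m)
      (fun D => I.loss t (D j t) θ) = expect (I.toMDP.stateLaw π t) fun s => I.loss t s θ := by
    intro t j
    obtain ⟨B, hB⟩ := hb.loss_bounded t.2 θ
    rw [← I.toMDP.trajectoryLaw_map_apply π t, expect_map _ _ _ ⟨B, hB⟩]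
    conv_rhs => rw [← iid_map_apply (I.toMDP.trajectoryLaw π) m j]
    exact (expect_map _ _ (fun x : Fin I.T → S => I.loss t (x t) θ) ⟨B, fun x => hB (x t)⟩).symm
  unfold empLoss expLoss
  rw [expect_const_mul, expect_sum]
  · simp only [expect_const_mul, expect_sum _ _ (fun t _ => hbd t _), h1]
    rw [Finset.sum_const, Finset.card_univ, Fintype.card_fin, nsmul_eq_mul,
      inv_mul_cancel_left₀ hm']
  · intro j _
    exact exists_abs_le_of_nonneg_of_le (B := b)
      (fun D => mul_nonneg (by positivity) (Finset.sum_nonneg fun t _ => I.loss_nonneg t.2 _ θ))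
      fun D => average_time_le fun t => hb t t.2 (D j t) θ

end Problem

/-! ### Concentration of the adaptively collected losses. -/

/-- Hoeffding's lemma for a discrete distribution. -/
lemma lexpect_exp_sub_expect_le {α : Type*} (p : PMF α) {f : α → ℝ} {b : ℝ}
    (h0 : ∀ x, 0 ≤ f x) (hb : ∀ x, f x ≤ b) (l : ℝ) :
    lexpect p (fun x => ENNReal.ofReal (Real.exp (l * (f x - expect p f)))) ≤
      ENNReal.ofReal (Real.exp (l ^ 2 * b ^ 2 / 8)) := by
  let _ : MeasurableSpace α := ⊤
  have : MeasurableSingletonClass α := ⟨fun _ => trivial⟩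
  have hm : ∀ g : α → ℝ, Measurable g := fun g => measurable_from_top
  have hE : ∀ g : α → ℝ, (∃ B, ∀ x, |g x| ≤ B) → ∫ x, g x ∂p.toMeasure = expect p g := by
    rintro g ⟨B, hB⟩
    rw [PMF.integral_eq_tsum p g (MeasureTheory.Integrable.of_bound (hm g).aestronglyMeasurable B
      (Filter.Eventually.of_forall hB))]
    rfl
  have hsub := (ProbabilityTheory.hasSubgaussianMGF_of_mem_Icc (μ := p.toMeasure) (X := f)
    (a := 0) (b := b) (hm f).aemeasurable
    (Filter.Eventually.of_forall fun x => ⟨h0 x, hb x⟩)).mgf_le l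
  rw [hE f (exists_abs_le_of_nonneg_of_le h0 hb), ProbabilityTheory.mgf] at hsub
  have hexp : ∃ B, ∀ x, |Real.exp (l * (f x - expect p f))| ≤ B := by
    refine ⟨Real.exp (|l| * (b + |expect p f|)), fun x => ?_⟩
    rw [abs_of_pos (Real.exp_pos _), Real.exp_le_exp]
    refine (le_abs_self _).trans ?_
    rw [abs_mul]
    refine mul_le_mul_of_nonneg_left ((abs_sub _ _).trans ?_) (abs_nonneg l)
    rw [abs_of_nonneg (h0 x)]
    linarith [hb x]
  rw [hE _ hexp] at hsub
  rw [← ofReal_expect p (fun x => (Real.exp_pos _).le) hexp]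
  refine ENNReal.ofReal_le_ofReal (hsub.trans (le_of_eq ?_))
  congr 1
  simp only [sub_zero, NNReal.coe_pow, NNReal.coe_div, coe_nnnorm, Real.norm_eq_abs,
    NNReal.coe_ofNat, div_pow, sq_abs]
  ring

namespace Problem

variable {S A : Type*} {d : ℕ} {I : Problem S A d} {m : ℕ}

/-- The datasets collected before iteration `i`. -/
def past {N : ℕ} (D : Fin N → I.Dataset m) (i : Fin N) : Fin i → I.Dataset m :=
  fun j => D (Fin.castLE i.isLt.le j)

lemma past_snoc_castSucc {N : ℕ} (D : Fin N → I.Dataset m) (D' : I.Dataset m) (i : Fin N) :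
    past (Fin.snoc D D' : Fin (N + 1) → I.Dataset m) i.castSucc = past D i := by
  ext j
  have : Fin.castLE i.castSucc.isLt.le j = (Fin.castLE i.isLt.le j).castSucc := rfl
  simp only [past]
  rw [this, Fin.snoc_castSucc (α := fun _ => I.Dataset m)]

lemma past_snoc_last {N : ℕ} (D : Fin N → I.Dataset m) (D' : I.Dataset m) :
    past (Fin.snoc D D' : Fin (N + 1) → I.Dataset m) (Fin.last N) = D := by
  ext j
  have : Fin.castLE (Fin.last N).isLt.le j = Fin.castSucc j := rfl
  simp only [past]
  rw [this, Fin.snoc_castSucc (α := fun _ => I.Dataset m)]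

namespace Learner

variable (L : I.Learner m)

/-- The accumulated deviations of a loss of the datasets from its conditional expectation. -/
noncomputable def deviation (g : (n : ℕ) → (Fin n → I.Dataset m) → I.Dataset m → ℝ) {N : ℕ}
    (D : Fin N → I.Dataset m) : ℝ :=
  ∑ i : Fin N, (g i (past D i) (D i) -
    expect (iid (I.toMDP.trajectoryLaw (L.rollout i (past D i))) m) (g i (past D i)))

lemma deviation_snoc (g : (n : ℕ) → (Fin n → I.Dataset m) → I.Dataset m → ℝ) {N : ℕ}
    (D : Fin N → I.Dataset m) (D' : I.Dataset m) :
    L.deviation g (Fin.snoc D D' : Fin (N + 1) → I.Dataset m) = L.deviation g D +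
      (g N D D' - expect (iid (I.toMDP.trajectoryLaw (L.rollout N D)) m) (g N D)) := by
  unfold deviation
  rw [Fin.sum_univ_castSucc]
  congr 1
  · refine Finset.sum_congr rfl fun i _ => ?_
    rw [past_snoc_castSucc, Fin.snoc_castSucc (α := fun _ => I.Dataset m)]
    rfl
  · rw [past_snoc_last, Fin.snoc_last (α := fun _ => I.Dataset m)]
    rfl

/-- Given the past, `g N D` is a fixed function of the new dataset, so Hoeffding's lemma contributes
one factor per round. This is what allows evaluation at the iterates. -/
lemma lexpect_exp_deviation_le {g : (n : ℕ) → (Fin n → I.Dataset m) → I.Dataset m → ℝ} {b : ℝ}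
    (h0 : ∀ n D D', 0 ≤ g n D D') (hb : ∀ n D D', g n D D' ≤ b) (l : ℝ) (N : ℕ) :
    lexpect (L.run N) (fun D => ENNReal.ofReal (Real.exp (l * L.deviation g D))) ≤
      ENNReal.ofReal (Real.exp (N * (l ^ 2 * b ^ 2 / 8))) := by
  induction N with
  | zero => simp [run, lexpect_pure, deviation]
  | succ N ih =>
    rw [run, lexpect_bind]
    simp only [lexpect_map, deviation_snoc, mul_add, Real.exp_add,
      ENNReal.ofReal_mul (Real.exp_pos _).le, lexpect_const_mul]
    calc _ ≤ lexpect (L.run N) (fun D => ENNReal.ofReal (Real.exp (l ^ 2 * b ^ 2 / 8)) *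
          ENNReal.ofReal (Real.exp (l * L.deviation g D))) := by
          refine lexpect_mono _ fun D => ?_
          rw [mul_comm]
          exact mul_le_mul_left (lexpect_exp_sub_expect_le _ (h0 N D) (hb N D) l) _
      _ ≤ ENNReal.ofReal (Real.exp (l ^ 2 * b ^ 2 / 8)) *
          ENNReal.ofReal (Real.exp (N * (l ^ 2 * b ^ 2 / 8))) := by
          rw [lexpect_const_mul]
          exact mul_le_mul_right ih _
      _ = _ := by
          rw [← ENNReal.ofReal_mul (Real.exp_pos _).le, ← Real.exp_add]
          congr 2
          push_cast
          ring

/-- The Azuma-Hoeffding inequality, for both tails. -/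
lemma toOuterMeasure_deviation_le {g : (n : ℕ) → (Fin n → I.Dataset m) → I.Dataset m → ℝ} {b : ℝ}
    (h0 : ∀ n D D', 0 ≤ g n D D') (hg : ∀ n D D', g n D D' ≤ b) (hb : 0 < b) {N : ℕ} (hN : 0 < N)
    {y : ℝ} (hy : 0 ≤ y) {e : ℝ} (he : e ^ 2 = 1) :
    (L.run N).toOuterMeasure {D | b * √(N * y) ≤ e * L.deviation g D} ≤
      ENNReal.ofReal (Real.exp (-y)) := by
  have hN' : (0 : ℝ) < N := by exact_mod_cast hN
  -- Half the optimal exponent; the resulting `exp (-(3 / 2) y)` is more than needed.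
  set l : ℝ := 2 * √(y / N) / b with hl
  have hl0 : 0 ≤ l := by positivity
  have h1 : l * (b * √(N * y)) = 2 * y := by
    have : √(y / N) * √(N * y) = y := by
      rw [← Real.sqrt_mul (by positivity), show y / N * (N * y) = y ^ 2 by field_simp,
        Real.sqrt_sq hy]
    calc l * (b * √(N * y)) = 2 * (√(y / N) * √(N * y)) := by rw [hl]; field_simp
      _ = 2 * y := by rw [this]
  have h2 : N * ((l * e) ^ 2 * b ^ 2 / 8) = y / 2 := by
    rw [mul_pow, he, hl, div_pow, mul_pow, Real.sq_sqrt (by positivity)]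
    field_simp
    ring
  calc _ ≤ (L.run N).toOuterMeasure {D | 1 ≤ ENNReal.ofReal (Real.exp (-(2 * y))) *
        ENNReal.ofReal (Real.exp (l * e * L.deviation g D))} := by
        refine MeasureTheory.measure_mono fun D hD => ?_
        simp only [Set.mem_ofPred_eq] at hD ⊢
        rw [← ENNReal.ofReal_mul (Real.exp_pos _).le, ← Real.exp_add, ENNReal.one_le_ofReal,
          Real.one_le_exp_iff]
        have := mul_le_mul_of_nonneg_left hD hl0
        rw [h1] at this
        linarith
    _ ≤ _ := toOuterMeasure_le_lexpect _ _
    _ ≤ ENNReal.ofReal (Real.exp (-(2 * y))) * ENNReal.ofReal (Real.exp (y / 2)) := by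
        rw [lexpect_const_mul, ← h2]
        exact mul_le_mul_right (L.lexpect_exp_deviation_le h0 hg (l * e) N) _
    _ ≤ _ := by
        rw [← ENNReal.ofReal_mul (Real.exp_pos _).le, ← Real.exp_add]
        exact ENNReal.ofReal_le_ofReal (Real.exp_le_exp.2 (by linarith))

end Learner

end Problem

/-! ### A net for convex sets that needs no metric. -/

section Net

variable {E : Type*} [AddCommGroup E] [Module ℝ E]

/-- A finite set of vectors contains a barycentric spanner: a family in which all its elements have
coordinates of absolute value at most one. -/
lemma exists_barycentric_spanner [FiniteDimensional ℝ E] (F : Finset E) :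
    ∃ k ≤ Module.finrank ℝ E, ∃ v : Fin k → E, (∀ i, v i ∈ F) ∧
      ∀ x ∈ F, ∃ a : Fin k → ℝ, (∀ i, |a i| ≤ 1) ∧ x = ∑ i, a i • v i := by
  obtain ⟨k, hk, f, hfF, hfs, hfi⟩ : ∃ k ≤ Module.finrank ℝ E, ∃ f : Fin k → E,
      (∀ i, f i ∈ F) ∧ Submodule.span ℝ (Set.range f) = Submodule.span ℝ (F : Set E) ∧
      LinearIndependent ℝ f :=
    ⟨_, Submodule.finrank_le _, Submodule.exists_fun_fin_finrank_span_eq ℝ (F : Set E)⟩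
  refine ⟨k, hk, ?_⟩
  set e := Module.Basis.span hfi
  have hmem : ∀ x : F, (x : E) ∈ Submodule.span ℝ (Set.range f) := fun x => by
    rw [hfs]; exact Submodule.subset_span x.2
  let lift : F → Submodule.span ℝ (Set.range f) := fun x => ⟨x, hmem x⟩
  let f' : Fin k → F := fun i => ⟨f i, hfF i⟩
  have : Nonempty (Fin k → F) := ⟨f'⟩
  -- The spanner is a tuple from `F` of maximal volume.
  obtain ⟨v, hv⟩ := Finite.exists_max fun v : Fin k → F => |e.det fun i => lift (v i)|
  have hdet : 0 < |e.det fun i => lift (v i)| := by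
    refine lt_of_lt_of_le one_pos ?_
    refine le_trans (le_of_eq ?_) (hv f')
    have : (fun i => lift (f' i)) = e := by
      ext i
      simp [lift, f', e, Module.Basis.span_apply]
    rw [this, e.det_self, abs_one]
  obtain ⟨hli, hsp⟩ := (e.is_basis_iff_det (v := fun i => lift (v i))).2
    (isUnit_iff_ne_zero.2 (abs_pos.1 hdet))
  let B := Module.Basis.mk hli hsp.ge
  refine ⟨fun i => v i, fun i => (v i).2, fun x hx => ⟨fun i => B.repr (lift ⟨x, hx⟩) i, ?_, ?_⟩⟩
  · intro i
    have hx' : lift ⟨x, hx⟩ = ∑ j, B.repr (lift ⟨x, hx⟩) j • lift (v j) := by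
      conv_lhs => rw [← B.sum_repr (lift ⟨x, hx⟩)]
      simp [B]
    have hup : (fun j => lift (Function.update v i ⟨x, hx⟩ j)) =
        Function.update (fun j => lift (v j)) i (lift ⟨x, hx⟩) := by
      ext j
      by_cases hj : j = i
      · subst hj; simp
      · simp [hj]
    have h := hv (Function.update v i ⟨x, hx⟩)
    -- Cramer's rule: exchanging `v i` for `x` multiplies the volume by the `i`-th coordinate of
    -- `x`, so maximality bounds that coordinate by `1`.
    have hdet' : e.det (Function.update (fun j => lift (v j)) i (lift ⟨x, hx⟩)) =
        B.repr (lift ⟨x, hx⟩) i * e.det fun j => lift (v j) := by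
      conv_lhs => rw [hx']
      rw [AlternatingMap.map_update_sum, Finset.sum_eq_single i]
      · rw [AlternatingMap.map_update_smul, Function.update_eq_self, smul_eq_mul]
      · intro j _ hj
        rw [AlternatingMap.map_update_smul, AlternatingMap.map_update_self _ _ (Ne.symm hj),
          smul_zero]
      · simp
    simp only [hup, hdet', abs_mul] at h
    exact le_of_mul_le_mul_right (by rwa [one_mul]) hdet
  · have := congrArg Subtype.val (B.sum_repr (lift ⟨x, hx⟩))
    simp only [Submodule.coe_sum, Submodule.coe_smul] at this
    refine (show x = ((lift ⟨x, hx⟩ : Submodule.span ℝ (Set.range f)) : E) from rfl).trans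
      (this.symm.trans (Finset.sum_congr rfl fun i _ => ?_))
    simp [B, lift]

lemma _root_.Convex.add_sum_smul_mem {K : Set E} (hK : Convex ℝ K) {x₀ : E} (hx₀ : x₀ ∈ K)
    {ι : Type*} [Fintype ι] {u : ι → E} (hu : ∀ i, x₀ + u i ∈ K) {c : ι → ℝ} (hc : ∀ i, 0 ≤ c i)
    (hs : ∑ i, c i ≤ 1) : x₀ + ∑ i, c i • u i ∈ K := by
  have h := hK.sum_mem (t := (Finset.univ : Finset (Option ι)))
    (w := fun o => o.elim (1 - ∑ i, c i) c) (z := fun o => o.elim x₀ fun i => x₀ + u i)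
    (by rintro (_ | i) _
        · simpa using hs
        · exact hc i)
    (by rw [Fintype.sum_option]; simp)
    (by rintro (_ | i) _
        · exact hx₀
        · exact hu i)
  rw [Fintype.sum_option] at h
  convert h using 1
  simp only [Option.elim, smul_add, Finset.sum_add_distrib, sub_smul, one_smul, ← Finset.sum_smul]
  abel

/-- Finitely many points of a convex set can be moved by a fraction `1 / N` of the way towards other
points of the set, so that they end in a set whose size depends only on `N` and the dimension. -/
lemma exists_convex_net [FiniteDimensional ℝ E] {K : Set E} (hK : Convex ℝ K) (F : Finset E)
    (hF : ↑F ⊆ K) {N : ℕ} (hN : 0 < N) :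
    ∃ Z : Finset E, ↑Z ⊆ K ∧
      Z.card ≤ (2 * (N * (Module.finrank ℝ E + 1) ^ 2) + 1) ^ Module.finrank ℝ E ∧
      ∀ x ∈ F, ∃ z ∈ Z, ∃ y ∈ K, z = (1 - (N : ℝ)⁻¹) • x + (N : ℝ)⁻¹ • y := by
  classical
  obtain rfl | ⟨x₀, hx₀⟩ := F.eq_empty_or_nonempty
  · exact ⟨∅, by simp, by simp, by simp⟩
  set n := Module.finrank ℝ E
  obtain ⟨k, hk, u, huF, ha⟩ := exists_barycentric_spanner (F.image fun x => x - x₀)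
  have hu : ∀ i, x₀ + u i ∈ K := fun i => by
    obtain ⟨x, hx, hxu⟩ := Finset.mem_image.1 (huF i)
    rw [← hxu, add_sub_cancel]
    exact hF hx
  have ha' : ∀ x, ∃ a : Fin k → ℝ, x ∈ F → (∀ i, |a i| ≤ 1) ∧ x - x₀ = ∑ i, a i • u i := by
    intro x
    by_cases hx : x ∈ F
    · obtain ⟨a, h⟩ := ha (x - x₀) (Finset.mem_image_of_mem _ hx)
      exact ⟨a, fun _ => h⟩
    · exact ⟨0, fun h => absurd h hx⟩
  choose a ha using ha'
  -- Coordinates are rounded to the grid of mesh `1 / q`; after multiplication by `N - 1` below, the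
  -- rounding error is still at most `1 / (n + 1) ^ 2`.
  set q : ℕ := N * (n + 1) ^ 2 with hq
  have hN' : (1 : ℝ) ≤ N := by exact_mod_cast hN
  have hq0 : (0 : ℝ) < q := by rw [hq]; push_cast; positivity
  let cell : E → Fin k → ℤ := fun x i => ⌊a x i * q⌋
  have hcell : ∀ x ∈ F, cell x ∈ Fintype.piFinset fun _ : Fin k => Finset.Icc (-(q : ℤ)) q := by
    intro x hx
    rw [Fintype.mem_piFinset]
    intro i
    have h := abs_le.1 ((ha x hx).1 i)
    rw [Finset.mem_Icc]
    constructor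
    · rw [Int.le_floor]
      push_cast
      nlinarith
    · refine Int.cast_le.1 ((Int.floor_le (a x i * q)).trans (?_ : _ ≤ ((q : ℤ) : ℝ)))
      push_cast
      nlinarith
  let rep := Function.invFunOn cell F
  -- The centroid of the simplex with vertices `x₀` and `x₀ + u i`. It leaves room for perturbations
  -- of its coordinates.
  let c : E := x₀ + ∑ i, ((k : ℝ) + 1)⁻¹ • u i
  have hk1 : (0 : ℝ) < (k : ℝ) + 1 := by positivity
  have hcK : c ∈ K := by
    refine hK.add_sum_smul_mem (hF hx₀) hu (fun i => by positivity) ?_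
    rw [Finset.sum_const, Finset.card_univ, Fintype.card_fin, nsmul_eq_mul,
      ← div_eq_mul_inv, div_le_one hk1]
    linarith
  have hinv0 : (0 : ℝ) ≤ (N : ℝ)⁻¹ := by positivity
  have hinv1 : (N : ℝ)⁻¹ ≤ 1 := inv_le_one_of_one_le₀ hN'
  refine ⟨(F.image cell).image fun w => (1 - (N : ℝ)⁻¹) • rep w + (N : ℝ)⁻¹ • c, ?_, ?_, ?_⟩
  · intro z hz
    simp only [Finset.coe_image, Set.mem_image, Finset.mem_coe] at hz
    obtain ⟨_, ⟨x, hx, rfl⟩, rfl⟩ := hz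
    exact hK (hF (Function.invFunOn_mem ⟨x, hx, rfl⟩)) hcK (by linarith) hinv0 (by ring)
  · calc _ ≤ (F.image cell).card := Finset.card_image_le
      _ ≤ (Fintype.piFinset fun _ : Fin k => Finset.Icc (-(q : ℤ)) q).card :=
        Finset.card_le_card (Finset.image_subset_iff.2 hcell)
      _ = (2 * q + 1) ^ k := by
        rw [Fintype.card_piFinset, Finset.prod_const, Finset.card_univ, Fintype.card_fin,
          Int.card_Icc]
        congr 1
        omega
      _ ≤ (2 * q + 1) ^ n := Nat.pow_le_pow_right (by omega) hk
  · intro x hx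
    set x' := rep (cell x)
    have hx' : x' ∈ F := Function.invFunOn_mem (s := (F : Set E)) (f := cell) ⟨x, hx, rfl⟩
    have hcc : cell x' = cell x := Function.invFunOn_eq (s := (F : Set E)) ⟨x, hx, rfl⟩
    -- The witness `y` is forced by solving `(1 - 1 / N) x' + c / N = (1 - 1 / N) x + y / N`, where
    -- `x'` represents the cell of `x`.
    refine ⟨_, Finset.mem_image_of_mem _ (Finset.mem_image_of_mem _ hx),
      c + ((N : ℝ) - 1) • (x' - x), ?_, ?_⟩
    · have hε : ∀ i, ((N : ℝ) - 1) * |a x' i - a x i| ≤ (((n : ℝ) + 1) ^ 2)⁻¹ := by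
        intro i
        have h1 : |a x' i * q - a x i * q| < 1 :=
          Int.abs_sub_lt_one_of_floor_eq_floor (congrFun hcc i)
        rw [← sub_mul, abs_mul, abs_of_pos hq0] at h1
        have hqe : (q : ℝ) = N * ((n : ℝ) + 1) ^ 2 := by rw [hq]; push_cast; ring
        rw [← one_div, le_div_iff₀ (by positivity)]
        have h2 : 0 ≤ |a x' i - a x i| * ((n : ℝ) + 1) ^ 2 := by positivity
        rw [hqe] at h1
        nlinarith
      have hy : c + ((N : ℝ) - 1) • (x' - x) =
          x₀ + ∑ i, (((k : ℝ) + 1)⁻¹ + ((N : ℝ) - 1) * (a x' i - a x i)) • u i := by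
        have : x' - x = ∑ i, (a x' i - a x i) • u i := by
          simp only [sub_smul, Finset.sum_sub_distrib]
          rw [← (ha x' hx').2, ← (ha x hx).2]
          abel
        rw [this]
        simp only [c, add_smul, Finset.sum_add_distrib, Finset.smul_sum, smul_smul]
        abel
      have hkn : (k : ℝ) ≤ n := by exact_mod_cast hk
      have hsq : ((k : ℝ) + 1) ^ 2 ≤ ((n : ℝ) + 1) ^ 2 := by gcongr
      have hsq' : (((n : ℝ) + 1) ^ 2)⁻¹ ≤ (((k : ℝ) + 1) ^ 2)⁻¹ :=
        inv_anti₀ (by positivity) hsq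
      rw [hy]
      refine hK.add_sum_smul_mem (hF hx₀) hu (fun i => ?_) ?_
      · have h1 := hε i
        have h2 : (((k : ℝ) + 1) ^ 2)⁻¹ ≤ ((k : ℝ) + 1)⁻¹ :=
          inv_anti₀ hk1 (by nlinarith [Nat.cast_nonneg (α := ℝ) k])
        have h3 := mul_le_mul_of_nonneg_left (neg_abs_le (a x' i - a x i))
          (sub_nonneg.2 hN')
        linarith
      -- The sum is `k (k + 2) / (k + 1) ^ 2`, just below `1`, so the perturbed centroid remains in
      -- the simplex.
      · calc _ ≤ ∑ _i : Fin k, (((k : ℝ) + 1)⁻¹ + (((k : ℝ) + 1) ^ 2)⁻¹) := by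
              refine Finset.sum_le_sum fun i _ => ?_
              have h3 := mul_le_mul_of_nonneg_left (le_abs_self (a x' i - a x i))
                (sub_nonneg.2 hN')
              linarith [hε i]
          _ = k * (((k : ℝ) + 1)⁻¹ + (((k : ℝ) + 1) ^ 2)⁻¹) := by simp [mul_add]
          _ ≤ 1 := by
              have : (0 : ℝ) ≤ k := Nat.cast_nonneg k
              field_simp
              nlinarith
    · have hN0 : (N : ℝ) ≠ 0 := by positivity
      change (1 - (N : ℝ)⁻¹) • x' + (N : ℝ)⁻¹ • c = _
      clear_value c x'
      rw [smul_add, smul_smul, show (N : ℝ)⁻¹ * ((N : ℝ) - 1) = 1 - (N : ℝ)⁻¹ by field_simp,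
        smul_sub]
      abel

end Net

/-! ### The high-probability bound for a learner with small regret. -/

lemma exists_finset_lt_toOuterMeasure {α : Type*} (p : PMF α) {c : ℝ≥0∞} (hc : c < 1) :
    ∃ s : Finset α, c < p.toOuterMeasure s := by
  rw [← p.tsum_coe, ENNReal.tsum_eq_iSup_sum, lt_iSup_iff] at hc
  obtain ⟨s, hs⟩ := hc
  exact ⟨s, by rwa [PMF.toOuterMeasure_apply_finset]⟩

namespace Problem

variable {S A : Type*} {d : ℕ} {I : Problem S A d} {m : ℕ} {b : ℝ}

namespace Learner

variable (L : I.Learner m)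

lemma iterate_eq {N : ℕ} (D : Fin N → I.Dataset m) (i : Fin N) :
    L.iterate D i = L i (past D i) := rfl

/-- Data are collected by the trained policy in every iteration but the first, where the oracle
acts; that one term costs at most `b`. -/
lemma abs_sum_expLoss_sub_rollout_le (hb : I.IsLossBound b) {N : ℕ} (hN : 0 < N)
    (D : Fin N → I.Dataset m) (x : Fin N → I.params) :
    |∑ i, I.expLoss (I.policy (L.iterate D i)) (x i) -
      ∑ i : Fin N, I.expLoss (L.rollout i (past D i)) (x i)| ≤ b := by
  rw [← Finset.sum_sub_distrib, Finset.sum_eq_single ⟨0, hN⟩]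
  · exact abs_sub_le_of_nonneg_of_le (expLoss_nonneg _ _) (hb.expLoss_le _ _)
      (expLoss_nonneg _ _) (hb.expLoss_le _ _)
  · intro i _ hi
    have : (i : ℕ) ≠ 0 := fun h => hi (Fin.ext h)
    rw [rollout, if_neg this, iterate_eq, sub_self]
  · simp

lemma deviation_empLoss (hb : I.IsLossBound b) (hm : 0 < m)
    (x : (n : ℕ) → (Fin n → I.Dataset m) → I.params) {N : ℕ} (D : Fin N → I.Dataset m) :
    L.deviation (fun n D D' => I.empLoss D' (x n D)) D =
      ∑ i : Fin N, I.empLoss (D i) (x i (past D i)) -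
        ∑ i : Fin N, I.expLoss (L.rollout i (past D i)) (x i (past D i)) := by
  simp only [deviation, hb.expect_empLoss hm, Finset.sum_sub_distrib]

/-- The number of deviations that the union bound controls. -/
def unionSize (d N : ℕ) : ℕ := (2 * (N * (d + 1) ^ 2) + 1) ^ d + 1

/-- If the empirical losses of the iterates and of `z` are close to their conditional expectations
and `z` lies `1 / N` of the way from a near-minimizer of the training loss, then one of the iterates
is close to the oracle. -/
lemma exists_J_le (hb : I.IsLossBound b) {N : ℕ} (hN : 0 < N) {γ e : ℝ} (hL : L.RegretLE N γ)
    (D : Fin N → I.Dataset m) {x y z : I.params}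
    (hx : (N : ℝ)⁻¹ * ∑ i, I.expLoss (I.policy (L.iterate D i)) x ≤ L.trainingLoss D + b / N)
    (hz : z.1 = (1 - (N : ℝ)⁻¹) • x.1 + (N : ℝ)⁻¹ • y.1)
    (h1 : ∑ i : Fin N, I.expLoss (L.rollout i (past D i)) (L.iterate D i) -
      ∑ i, I.empLoss (D i) (L.iterate D i) ≤ e)
    (h2 : ∑ i, I.empLoss (D i) z - ∑ i : Fin N, I.expLoss (L.rollout i (past D i)) z ≤ e) :
    ∃ i : Fin N, I.toMDP.J (I.policy (L.iterate D i)) ≤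
      I.toMDP.J I.oracle + I.T * L.trainingLoss D + I.T * (4 * b + 2 * e + N * γ) / N := by
  have hN' : (0 : ℝ) < N := by exact_mod_cast hN
  have hT : (0 : ℝ) < I.T := by exact_mod_cast I.T_pos
  -- The `4 * b` arises from the first iteration counted twice (for the iterates and for `z`), the
  -- move from `x` to `z`, and the near-minimality of `x`.
  have h3 := (abs_le.1 (L.abs_sum_expLoss_sub_rollout_le hb hN D (L.iterate D))).2
  have h4 := (abs_le.1 (L.abs_sum_expLoss_sub_rollout_le hb hN D fun _ => z)).1
  have h5 := hL D z
  rw [inv_mul_le_iff₀ hN', mul_add, mul_inv_cancel_left₀ hN'.ne'] at h5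
  rw [inv_mul_le_iff₀ hN', mul_add, mul_div_cancel₀ _ hN'.ne'] at hx
  have h6 : ∑ i, I.expLoss (I.policy (L.iterate D i)) z ≤
      ∑ i, I.expLoss (I.policy (L.iterate D i)) x + b := by
    have hinv0 : (0 : ℝ) ≤ (N : ℝ)⁻¹ := by positivity
    have hinv1 : (N : ℝ)⁻¹ ≤ 1 := inv_le_one_of_one_le₀ (by exact_mod_cast hN)
    calc ∑ i, I.expLoss (I.policy (L.iterate D i)) z
        ≤ ∑ i, (I.expLoss (I.policy (L.iterate D i)) x + (N : ℝ)⁻¹ * b) := by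
          refine Finset.sum_le_sum fun i _ => ?_
          have h := hb.expLoss_convex (I.policy (L.iterate D i)) (sub_nonneg.2 hinv1) hinv0
            (by ring) hz
          have h' := mul_le_mul_of_nonneg_left
            (hb.expLoss_le (I.policy (L.iterate D i)) y) hinv0
          have h'' := mul_nonneg hinv0 (expLoss_nonneg (I.policy (L.iterate D i)) x)
          linarith
      _ = _ := by
          rw [Finset.sum_add_distrib, Finset.sum_const, Finset.card_univ, Fintype.card_fin,
            nsmul_eq_mul, mul_inv_cancel_left₀ hN'.ne']
  have h7 : ∑ i, I.expLoss (I.policy (L.iterate D i)) (L.iterate D i) ≤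
      ∑ _i : Fin N, (L.trainingLoss D + (4 * b + 2 * e + N * γ) / N) := by
    rw [Finset.sum_const, Finset.card_univ, Fintype.card_fin, nsmul_eq_mul, mul_add,
      mul_div_cancel₀ _ hN'.ne']
    linarith
  obtain ⟨i, -, hi⟩ := Finset.exists_le_of_sum_le ⟨⟨0, hN⟩, Finset.mem_univ _⟩ h7
  refine ⟨i, (hb.J_le _).trans ?_⟩
  have := mul_le_mul_of_nonneg_left hi hT.le
  rw [mul_add, ← mul_div_assoc] at this
  linarith

lemma successProb_mono {N : ℕ} {e e' : ℝ} (h : e ≤ e') : L.successProb N e ≤ L.successProb N e' :=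
  MeasureTheory.measure_mono fun _ ⟨i, hi⟩ => ⟨i, hi.trans (by linarith)⟩

theorem le_successProb (hb : I.IsLossBound b) (hb0 : 0 < b) (hm : 0 < m) {N : ℕ} (hN : 0 < N)
    {γ δ : ℝ} (hδ : 0 < δ) (hδ1 : δ < 1) (hL : L.RegretLE N γ) :
    ENNReal.ofReal (1 - δ) ≤ L.successProb N
      (I.T * (4 * b + 2 * (b * √(N * Real.log (2 * unionSize d N / δ))) + N * γ) / N) := by
  classical
  have hN' : (0 : ℝ) < N := by exact_mod_cast hN
  set U : ℝ := ((unionSize d N : ℕ) : ℝ) with hU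
  have hU1 : 1 ≤ U := by
    rw [hU, unionSize]
    exact_mod_cast Nat.le_add_left _ _
  set y : ℝ := Real.log (2 * U / δ) with hy
  have hy0 : 0 ≤ y := Real.log_nonneg (by rw [le_div_iff₀ hδ]; linarith)
  set e : ℝ := b * √(N * y) with he
  -- Half of `δ` is spent on restricting to finitely many data sequences, so that the net built from
  -- their near-minimizers is deterministic.
  obtain ⟨s, hs⟩ := exists_finset_lt_toOuterMeasure (L.run N)
    (c := ENNReal.ofReal (1 - δ / 2)) (by rw [ENNReal.ofReal_lt_one]; linarith)
  have hmin : ∀ D : Fin N → I.Dataset m, ∃ x : I.params,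
      (N : ℝ)⁻¹ * ∑ i, I.expLoss (I.policy (L.iterate D i)) x ≤ L.trainingLoss D + b / N := by
    intro D
    have : Nonempty I.params := ⟨L 0 Fin.elim0⟩
    obtain ⟨x, hx⟩ := exists_lt_of_ciInf_lt
      (lt_add_of_pos_right (L.trainingLoss D) (div_pos hb0 hN'))
    exact ⟨x, hx.le⟩
  choose x hx using hmin
  obtain ⟨Z, hZK, hZ, hZx⟩ := exists_convex_net (I.surrogate_convex I.init).1
    (s.image fun D => (x D).1) (by
      intro v hv
      simp only [Finset.coe_image, Set.mem_image] at hv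
      obtain ⟨D, -, rfl⟩ := hv
      exact (x D).2) hN
  rw [finrank_euclideanSpace_fin] at hZ
  let z : Z → I.params := fun v => ⟨v, hZK v.2⟩
  let g₀ : (n : ℕ) → (Fin n → I.Dataset m) → I.Dataset m → ℝ := fun n D D' => I.empLoss D' (L n D)
  let g : Z → (n : ℕ) → (Fin n → I.Dataset m) → I.Dataset m → ℝ := fun v _ _ D' =>
    I.empLoss D' (z v)
  -- The iterates need the lower tail and the net points the upper tail; `bad₀` is the final `+ 1`
  -- in `unionSize`.
  let bad₀ : Set (Fin N → I.Dataset m) := {D | e ≤ -1 * L.deviation g₀ D}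
  let bad : Z → Set (Fin N → I.Dataset m) := fun v => {D | e ≤ 1 * L.deviation (g v) D}
  set good : Set (Fin N → I.Dataset m) := {D | ∃ i : Fin N,
    I.toMDP.J (I.policy (L.iterate D i)) ≤ I.toMDP.J I.oracle + I.T * L.trainingLoss D +
      I.T * (4 * b + 2 * e + N * γ) / N} with hgood
  have hbad₀ : (L.run N).toOuterMeasure bad₀ ≤ ENNReal.ofReal (Real.exp (-y)) :=
    L.toOuterMeasure_deviation_le (fun _ _ _ => empLoss_nonneg _ _)
      (fun _ _ _ => hb.empLoss_le hm _ _) hb0 hN hy0 (by norm_num)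
  have hbad : ∀ v, (L.run N).toOuterMeasure (bad v) ≤ ENNReal.ofReal (Real.exp (-y)) := fun v =>
    L.toOuterMeasure_deviation_le (fun _ _ _ => empLoss_nonneg _ _)
      (fun _ _ _ => hb.empLoss_le hm _ _) hb0 hN hy0 (by norm_num)
  have hsub : (s : Set (Fin N → I.Dataset m)) ⊆ good ∪ (bad₀ ∪ ⋃ v, bad v) := by
    intro D hD
    by_contra hcon
    simp only [Set.mem_union, Set.mem_iUnion, not_or, not_exists] at hcon
    obtain ⟨hg, h0, hv⟩ := hcon
    obtain ⟨v, hvZ, w, hwK, hvw⟩ := hZx (x D).1 (Finset.mem_image_of_mem _ hD)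
    have h0' : -1 * L.deviation g₀ D < e := not_le.1 h0
    have hv' : 1 * L.deviation (g ⟨v, hvZ⟩) D < e := not_le.1 (hv ⟨v, hvZ⟩)
    rw [L.deviation_empLoss hb hm fun n D => L n D] at h0'
    rw [L.deviation_empLoss hb hm fun _ _ => z ⟨v, hvZ⟩] at hv'
    refine hg (L.exists_J_le hb hN hL D (hx D) (y := ⟨w, hwK⟩) (z := z ⟨v, hvZ⟩) hvw ?_ ?_)
    · simp only [iterate_eq]
      linarith
    · linarith
  have hunion : (L.run N).toOuterMeasure (bad₀ ∪ ⋃ v, bad v) ≤ ENNReal.ofReal (δ / 2) := by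
    calc _ ≤ (L.run N).toOuterMeasure bad₀ + ∑ v, (L.run N).toOuterMeasure (bad v) :=
          (MeasureTheory.measure_union_le _ _).trans
            (add_le_add_right (MeasureTheory.measure_iUnion_fintype_le _ _) _)
      _ ≤ ENNReal.ofReal (Real.exp (-y)) + ∑ _v : Z, ENNReal.ofReal (Real.exp (-y)) :=
          add_le_add hbad₀ (Finset.sum_le_sum fun v _ => hbad v)
      _ = ENNReal.ofReal ((Z.card + 1) * Real.exp (-y)) := by
          rw [Finset.sum_const, Finset.card_univ, Fintype.card_coe, nsmul_eq_mul,
            ENNReal.ofReal_mul (by positivity), ENNReal.ofReal_add (by positivity) zero_le_one,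
            ENNReal.ofReal_natCast, ENNReal.ofReal_one]
          ring
      _ ≤ ENNReal.ofReal (U * Real.exp (-y)) := by
          refine ENNReal.ofReal_le_ofReal (mul_le_mul_of_nonneg_right ?_ (Real.exp_pos _).le)
          rw [hU, unionSize]
          exact_mod_cast Nat.add_le_add_right hZ 1
      _ = ENNReal.ofReal (δ / 2) := by
          rw [Real.exp_neg, hy, Real.exp_log (by positivity)]
          congr 1
          field_simp
  have hfin : ENNReal.ofReal (1 - δ / 2) ≤
      (L.run N).toOuterMeasure good + ENNReal.ofReal (δ / 2) :=
    hs.le.trans ((MeasureTheory.measure_mono hsub).trans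
      ((MeasureTheory.measure_union_le _ _).trans (add_le_add_right hunion _)))
  rw [show 1 - δ = (1 - δ / 2) - δ / 2 by ring, ENNReal.ofReal_sub _ (by positivity)]
  exact tsub_le_iff_right.2 hfin

end Learner

end Problem

/-! ### Logarithmic regret of follow-the-leader. -/

namespace Problem

variable {S A : Type*} {d : ℕ} {I : Problem S A d} {m : ℕ} {b κ : ℝ} {G : NNReal}

variable (I) in
/-- The average weight of the states of a dataset. -/
noncomputable def avgWeight (D : I.Dataset m) : ℝ :=
  (m : ℝ)⁻¹ * ∑ j, (I.T : ℝ)⁻¹ * ∑ t : Fin I.T, I.toMDP.weight I.oracle t (D j t)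

lemma avgWeight_nonneg (D : I.Dataset m) : 0 ≤ I.avgWeight D :=
  mul_nonneg (by positivity) (Finset.sum_nonneg fun j _ => mul_nonneg (by positivity)
    (Finset.sum_nonneg fun t _ => I.toMDP.weight_nonneg _ t.2 _))

lemma avgWeight_le (hm : 0 < m) (hw : ∀ t < I.T, ∀ s, I.toMDP.weight I.oracle t s ≤ b)
    (D : I.Dataset m) : I.avgWeight D ≤ b := by
  have hm' : (0 : ℝ) < m := by exact_mod_cast hm
  rw [avgWeight, inv_mul_le_iff₀ hm']
  calc _ ≤ ∑ _j : Fin m, b :=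
        Finset.sum_le_sum fun j _ => IsLossBound.average_time_le fun t => hw t t.2 (D j t)
    _ = m * b := by simp

/-- An inequality that is affine in the surrogate losses passes to the empirical losses. -/
lemma empLoss_affine_le {x y z : I.params} {a c e : ℝ}
    (h : ∀ s, I.surrogate s z ≤ a * I.surrogate s x + c * I.surrogate s y + e) (D : I.Dataset m) :
    I.empLoss D z ≤ a * I.empLoss D x + c * I.empLoss D y + e * I.avgWeight D := by
  have key : I.empLoss D z ≤ (m : ℝ)⁻¹ * ∑ j, (I.T : ℝ)⁻¹ * ∑ t : Fin I.T,
      (a * I.loss t (D j t) x + c * I.loss t (D j t) y +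
        e * I.toMDP.weight I.oracle t (D j t)) := by
    refine mul_le_mul_of_nonneg_left (Finset.sum_le_sum fun j _ => mul_le_mul_of_nonneg_left
      (Finset.sum_le_sum fun t _ => ?_) (by positivity)) (by positivity)
    have := mul_le_mul_of_nonneg_left (h (D j t)) (I.toMDP.weight_nonneg I.oracle t.2 (D j t))
    unfold loss
    linarith
  refine key.trans (le_of_eq ?_)
  simp only [empLoss, avgWeight, Finset.sum_add_distrib, ← Finset.mul_sum, mul_add]
  ring

/-- The empirical loss inherits the strong convexity scaled by the average weight of the dataset,
which may vanish; the regret analysis therefore measures time by accumulated weight. -/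
lemma empLoss_midpoint_le (hs : ∀ s, StrongConvexOn I.params κ (I.surrogate s))
    {x y z : I.params} (hz : z.1 = (2⁻¹ : ℝ) • x.1 + (2⁻¹ : ℝ) • y.1) (D : I.Dataset m) :
    I.empLoss D z ≤ 2⁻¹ * I.empLoss D x + 2⁻¹ * I.empLoss D y +
      -(κ / 8 * ‖x.1 - y.1‖ ^ 2) * I.avgWeight D := by
  refine empLoss_affine_le (fun s => ?_) D
  have h := (hs s).2 x.2 y.2 (by norm_num : (0 : ℝ) ≤ 2⁻¹) (by norm_num : (0 : ℝ) ≤ 2⁻¹)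
    (by norm_num)
  rw [← hz, smul_eq_mul, smul_eq_mul] at h
  linarith

lemma empLoss_sub_le (hG : ∀ s, LipschitzOnWith G (I.surrogate s) I.params) (x y : I.params)
    (D : I.Dataset m) :
    I.empLoss D x - I.empLoss D y ≤ I.avgWeight D * (G * ‖x.1 - y.1‖) := by
  have h := empLoss_affine_le (z := x) (x := y) (y := y) (a := 1) (c := 0)
    (e := G * ‖x.1 - y.1‖) (fun s => by
      have := (le_abs_self _).trans ((hG s).dist_le_mul x.1 x.2 y.1 y.2)
      rw [dist_eq_norm] at this
      linarith) D
  linarith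

/-- The amount by which the regret of follow-the-leader grows in a round of weight `w`. -/
lemma regret_increment_le {w W Δ f : ℝ} (hκ : 0 < κ) (hw : 0 ≤ w) (hwb : w ≤ b) (hwW : w ≤ W)
    (hΔ : 0 ≤ Δ) (h1 : f ≤ w * (G * Δ)) (h2 : κ / 4 * W * Δ ^ 2 ≤ f) :
    f ≤ 8 * G ^ 2 / κ * b * (Real.log (b + W) - Real.log (b + (W - w))) := by
  obtain rfl | hw0 := hw.eq_or_lt
  · simpa using h1
  have hb : 0 < b := hw0.trans_le hwb
  have hW : 0 < W := hw0.trans_le hwW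
  have hG0 : (0 : ℝ) ≤ G := G.2
  have hlog : w / (b + W) ≤ Real.log (b + W) - Real.log (b + (W - w)) := by
    have hA : 0 < b + (W - w) := by linarith
    have hB : 0 < b + W := by linarith
    rw [← Real.log_div hB.ne' hA.ne']
    refine le_trans (le_of_eq ?_) (Real.one_sub_inv_le_log_of_pos (div_pos hB hA))
    field_simp
    ring
  -- Quadratic growth against Lipschitz continuity: the leader moves by at most order `w / W`.
  have hdist : κ * W * Δ ≤ 4 * w * G := by
    obtain rfl | hΔ0 := hΔ.eq_or_lt
    · rw [mul_zero]; positivity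
    · have := h2.trans h1
      refine le_of_mul_le_mul_right ?_ hΔ0
      nlinarith
  calc f ≤ w * (G * Δ) := h1
    _ ≤ w * (G * (4 * w * G / (κ * W))) := by
        gcongr
        rw [le_div_iff₀ (by positivity)]
        linarith
    _ = 4 * G ^ 2 / κ * w * (w / W) := by field_simp
    -- Since `w ≤ b` and `w ≤ W`, adding `b` to the denominator costs a factor `2` and keeps the
    -- telescoping logarithm finite from `W = 0` on.
    _ ≤ 4 * G ^ 2 / κ * w * (2 * b / (b + W)) := by
        refine mul_le_mul_of_nonneg_left ?_ (by positivity)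
        rw [div_le_div_iff₀ hW (by linarith)]
        nlinarith
    _ = 8 * G ^ 2 / κ * b * (w / (b + W)) := by ring
    _ ≤ _ := mul_le_mul_of_nonneg_left hlog (by positivity)

namespace Learner

variable {L : I.Learner m}

/-- A minimizer of the aggregated loss is separated from all other parameters. -/
lemma IsFollowTheLeader.quadratic_growth (hL : L.IsFollowTheLeader)
    (hs : ∀ s, StrongConvexOn I.params κ (I.surrogate s)) {N : ℕ} (D : Fin N → I.Dataset m)
    (x : I.params) :
    κ / 4 * (∑ i, I.avgWeight (D i)) * ‖x.1 - (L N D).1‖ ^ 2 ≤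
      ∑ i, I.empLoss (D i) x - ∑ i, I.empLoss (D i) (L N D) := by
  have hmem := (hs I.init).1 x.2 (L N D).2 (by norm_num : (0 : ℝ) ≤ 2⁻¹)
    (by norm_num : (0 : ℝ) ≤ 2⁻¹) (by norm_num)
  -- Optimality against the midpoint with `x` suffices.
  have h1 := hL N D ⟨_, hmem⟩
  have h2 := Finset.sum_le_sum fun (i : Fin N) (_ : i ∈ Finset.univ) =>
    empLoss_midpoint_le hs (z := ⟨_, hmem⟩) rfl (D i)
  rw [Finset.sum_add_distrib, Finset.sum_add_distrib, ← Finset.mul_sum, ← Finset.mul_sum,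
    ← Finset.mul_sum] at h2
  linarith

/-- The regret against the current leader grows in a round by the old leader's excess on the
enlarged data, which `regret_increment_le` bounds by a telescoping term. -/
lemma IsFollowTheLeader.sum_empLoss_le (hL : L.IsFollowTheLeader) (hm : 0 < m) (hκ : 0 < κ)
    (hw : ∀ t < I.T, ∀ s, I.toMDP.weight I.oracle t s ≤ b)
    (hs : ∀ s, StrongConvexOn I.params κ (I.surrogate s))
    (hG : ∀ s, LipschitzOnWith G (I.surrogate s) I.params) (N : ℕ) (D : Fin N → I.Dataset m) :
    ∑ i, I.empLoss (D i) (L.iterate D i) ≤ ∑ i, I.empLoss (D i) (L N D) +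
      8 * G ^ 2 / κ * b * (Real.log (b + ∑ i, I.avgWeight (D i)) - Real.log b) := by
  induction N with
  | zero => simp
  | succ N ih =>
    let D₀ : Fin N → I.Dataset m := fun j => D j.castSucc
    have hlast : L.iterate D (Fin.last N) = L N D₀ := rfl
    have hcast : ∀ i : Fin N, L.iterate D i.castSucc = L.iterate D₀ i := fun _ => rfl
    -- The old leader is optimal on the old data, so only the newest dataset can separate it from
    -- the new leader.
    have h1 : ∑ i, I.empLoss (D i) (L N D₀) - ∑ i, I.empLoss (D i) (L (N + 1) D) ≤
        I.avgWeight (D (Fin.last N)) * (G * ‖(L N D₀).1 - (L (N + 1) D).1‖) := by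
      rw [Fin.sum_univ_castSucc, Fin.sum_univ_castSucc]
      have h2 := hL N D₀ (L (N + 1) D)
      have h3 := empLoss_sub_le hG (L N D₀) (L (N + 1) D) (D (Fin.last N))
      simp only [D₀] at h2 h3 ⊢
      linarith
    have h2 := regret_increment_le hκ (avgWeight_nonneg _) (avgWeight_le hm hw (D (Fin.last N)))
      (Finset.single_le_sum (f := fun i => I.avgWeight (D i)) (fun i _ => avgWeight_nonneg _)
        (Finset.mem_univ (Fin.last N))) (norm_nonneg _) h1 (hL.quadratic_growth hs D _)
    have h3 := ih D₀
    have hW : ∑ i, I.avgWeight (D i) - I.avgWeight (D (Fin.last N)) =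
        ∑ i, I.avgWeight (D₀ i) := by
      rw [Fin.sum_univ_castSucc]
      ring
    rw [hW] at h2
    have h4 : ∑ i, I.empLoss (D i) (L.iterate D i) =
        ∑ i, I.empLoss (D₀ i) (L.iterate D₀ i) + I.empLoss (D (Fin.last N)) (L N D₀) := by
      rw [Fin.sum_univ_castSucc]
      rfl
    have h5 : ∑ i, I.empLoss (D i) (L N D₀) =
        ∑ i, I.empLoss (D₀ i) (L N D₀) + I.empLoss (D (Fin.last N)) (L N D₀) := by
      rw [Fin.sum_univ_castSucc]
    rw [h4]
    linarith

/-- Follow-the-leader has logarithmic regret on strongly convex Lipschitz losses. -/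
theorem IsFollowTheLeader.regretLE (hL : L.IsFollowTheLeader) (hm : 0 < m) (hκ : 0 < κ)
    (hw : ∀ t < I.T, ∀ s, I.toMDP.weight I.oracle t s ≤ b)
    (hs : ∀ s, StrongConvexOn I.params κ (I.surrogate s))
    (hG : ∀ s, LipschitzOnWith G (I.surrogate s) I.params) (N : ℕ) :
    L.RegretLE N ((N : ℝ)⁻¹ * (8 * G ^ 2 / κ * b * Real.log (1 + N))) := by
  intro D θ
  have hb : 0 ≤ b := (I.toMDP.weight_nonneg I.oracle I.T_pos I.init).trans (hw 0 I.T_pos I.init)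
  rw [← mul_add]
  refine mul_le_mul_of_nonneg_left ?_ (by positivity)
  refine (hL.sum_empLoss_le hm hκ hw hs hG N D).trans (add_le_add (hL N D θ) ?_)
  obtain rfl | hb0 := hb.eq_or_lt
  · simp
  refine mul_le_mul_of_nonneg_left ?_ (by positivity)
  have hW0 : 0 ≤ ∑ i, I.avgWeight (D i) := Finset.sum_nonneg fun i _ => avgWeight_nonneg _
  have hW : ∑ i, I.avgWeight (D i) ≤ N * b := by
    calc _ ≤ ∑ _i : Fin N, b := Finset.sum_le_sum fun i _ => avgWeight_le hm hw (D i)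
      _ = N * b := by simp
  rw [← Real.log_div (by positivity) hb0.ne']
  refine Real.log_le_log (by positivity) ?_
  rw [div_le_iff₀ hb0]
  linarith

end Learner

end Problem

/-! ### Trading logarithms of `N` for logarithms of `X`. -/

lemma one_add_log_pow_le {u : ℝ} (hu : 1 ≤ u) (n : ℕ) :
    (1 + Real.log u) ^ n ≤ Real.exp 1 * n.factorial * u := by
  have h := Real.pow_div_factorial_le_exp (1 + Real.log u)
    (by linarith [Real.log_nonneg hu]) n
  rw [Real.exp_add, Real.exp_log (by linarith), div_le_iff₀ (by positivity)] at h
  linarith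

lemma one_le_one_add_log {x : ℝ} (hx : 0 ≤ x) : 1 ≤ 1 + Real.log (1 + x) := by
  linarith [Real.log_nonneg (by linarith : 1 ≤ 1 + x)]

/-- Polylogarithmic factors of `N` become polylogarithmic factors of `X` once `N` is at least of
order `X`. -/
lemma mul_one_add_log_pow_div_le {X N c : ℝ} (hX : 0 ≤ X) (hN : 1 ≤ N) {k : ℕ}
    (h : X ≤ polylog c k X * N) (n : ℕ) :
    X * (1 + Real.log (1 + N)) ^ n / N ≤
      (c + 2) * (Real.exp 1 * n.factorial) * (1 + Real.log (1 + X)) ^ (k + n) := by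
  have hN0 : 0 < N := by linarith
  have hX1 : 0 < 1 + X := by linarith
  set l := 1 + Real.log (1 + X) with hl
  have hl1 : 1 ≤ l := one_le_one_add_log hX
  -- `u` measures how far `N` exceeds `X`. Powers of `1 + log u` are at most linear in `u`, and the
  -- division by `N` absorbs this.
  set u := 1 + (1 + N) / (1 + X) with hu
  have hu1 : 1 ≤ u := by
    have : 0 ≤ (1 + N) / (1 + X) := by positivity
    linarith
  have hNu : 1 + N ≤ (1 + X) * u := by
    rw [hu, mul_add, mul_div_cancel₀ _ hX1.ne']
    linarith
  have hlog : 1 + Real.log (1 + N) ≤ l * (1 + Real.log u) := by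
    have h1 := Real.log_le_log (by linarith) hNu
    rw [Real.log_mul hX1.ne' (by linarith)] at h1
    have h2 := Real.log_nonneg hu1
    nlinarith
  have hXu : X * u / N ≤ (c + 2) * l ^ k := by
    have h1 : X / N ≤ c * l ^ k := by
      rw [div_le_iff₀ hN0]
      exact h
    have h2 : X * ((1 + N) / (1 + X)) / N ≤ 2 := by
      rw [div_le_iff₀ hN0, mul_div_assoc', div_le_iff₀ hX1]
      nlinarith
    have h3 : 1 ≤ l ^ k := one_le_pow₀ hl1
    calc X * u / N = X / N + X * ((1 + N) / (1 + X)) / N := by rw [hu]; ring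
      _ ≤ c * l ^ k + 2 * l ^ k := by linarith
      _ = _ := by ring
  calc X * (1 + Real.log (1 + N)) ^ n / N
      ≤ X * (l ^ n * (Real.exp 1 * n.factorial * u)) / N := by
        have h0 : 0 ≤ 1 + Real.log (1 + N) := by linarith [one_le_one_add_log hN0.le]
        have := pow_le_pow_left₀ h0 hlog n
        rw [mul_pow] at this
        gcongr
        exact this.trans (mul_le_mul_of_nonneg_left (one_add_log_pow_le hu1 n) (by positivity))
    _ = X * u / N * (Real.exp 1 * n.factorial * l ^ n) := by ring
    _ ≤ (c + 2) * l ^ k * (Real.exp 1 * n.factorial * l ^ n) :=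
        mul_le_mul_of_nonneg_right hXu (by positivity)
    _ = _ := by rw [pow_add]; ring

/-! ### The final polylogarithmic estimate. -/

namespace Problem.Learner

open Problem

/-- The coefficient in the logarithmic bound on the size of the union bound. -/
noncomputable def unionCoeff (d : ℕ) : ℝ := Real.log (4 * (3 * ((d : ℝ) + 1) ^ 2) ^ d) + d

lemma unionCoeff_nonneg (d : ℕ) : 0 ≤ unionCoeff d := by
  have h : (1 : ℝ) ≤ (3 * ((d : ℝ) + 1) ^ 2) ^ d := by
    refine one_le_pow₀ ?_
    nlinarith [Nat.cast_nonneg (α := ℝ) d]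
  exact add_nonneg (Real.log_nonneg (by linarith)) (Nat.cast_nonneg d)

lemma log_two_mul_unionSize_le (d N : ℕ) :
    Real.log (2 * unionSize d N) ≤ unionCoeff d * (1 + Real.log (1 + N)) := by
  have hN : (0 : ℝ) ≤ N := Nat.cast_nonneg N
  have hd : (0 : ℝ) ≤ d := Nat.cast_nonneg d
  set B : ℝ := 3 * ((d : ℝ) + 1) ^ 2 with hB
  have hB1 : 1 ≤ B := by nlinarith
  have hBd : 1 ≤ B ^ d := one_le_pow₀ hB1
  have hBN : 1 ≤ (B * (1 + N)) ^ d := one_le_pow₀ (by nlinarith)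
  have hsize : (2 * unionSize d N : ℝ) ≤ 4 * B ^ d * (1 + N) ^ d := by
    have h : (2 * (N * ((d : ℝ) + 1) ^ 2) + 1) ^ d ≤ (B * (1 + N)) ^ d := by
      refine pow_le_pow_left₀ (by positivity) ?_ d
      nlinarith [mul_nonneg hN (sq_nonneg ((d : ℝ) + 1))]
    rw [unionSize]
    push_cast
    rw [mul_assoc, ← mul_pow]
    linarith
  have hpos : (0 : ℝ) < 2 * unionSize d N := by
    rw [unionSize]
    positivity
  calc Real.log (2 * unionSize d N) ≤ Real.log (4 * B ^ d * (1 + N) ^ d) :=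
        Real.log_le_log hpos hsize
    _ = Real.log (4 * B ^ d) + d * Real.log (1 + N) := by
        rw [Real.log_mul (by positivity) (by positivity), Real.log_pow]
    _ ≤ _ := by
        have h1 : 0 ≤ Real.log (4 * B ^ d) := Real.log_nonneg (by linarith)
        have h2 : 0 ≤ Real.log (1 + (N : ℝ)) := Real.log_nonneg (by linarith)
        rw [unionCoeff, ← hB]
        nlinarith [mul_nonneg h1 h2]

/-- The case `b = 0` is separate because the concentration argument divides by `b`. -/
lemma successProb_eq_one_of_bound_zero {S A : Type*} {d : ℕ} {I : Problem S A d} {m : ℕ}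
    (L : I.Learner m) (hb : I.IsLossBound 0) {N : ℕ} (hN : 0 < N) {e : ℝ} (he : 0 ≤ e) :
    L.successProb N e = 1 := by
  rw [successProb, PMF.toOuterMeasure_apply_eq_one_iff]
  intro D _
  refine ⟨⟨0, hN⟩, (hb.J_le _).trans ?_⟩
  have h1 := hb.expLoss_le (I.policy (L.iterate D ⟨0, hN⟩)) (L.iterate D ⟨0, hN⟩)
  have h2 : 0 ≤ L.trainingLoss D := Real.iInf_nonneg fun θ =>
    mul_nonneg (by positivity) (Finset.sum_nonneg fun i _ => expLoss_nonneg _ _)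
  have hT : (0 : ℝ) ≤ I.T := Nat.cast_nonneg _
  have h3 := mul_le_mul_of_nonneg_left h1 hT
  have h4 := mul_nonneg hT h2
  linarith

/-- The excess of the cost is at most `√(X / N)` up to logarithmic factors of `N`. -/
lemma excess_le {b δ a r : ℝ} {d N T q : ℕ} (hb : 0 ≤ b) (hN : 0 < N) (hδ : 0 < δ) (ha : 0 < a)
    (haδ : a ≤ Real.log (1 / δ)) :
    T * (4 * b + 2 * (b * √(N * Real.log (2 * unionSize d N / δ))) +
        N * (b * polylog r q N / √N)) / N ≤
      (4 / √a + 2 * √(1 + unionCoeff d / a) + |r| / √a) *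
        √(order b T δ * (1 + Real.log (1 + N)) ^ (2 * (q + 1)) / N) := by
  have hN' : (1 : ℝ) ≤ N := by exact_mod_cast hN
  set Λ := Real.log (1 / δ) with hΛ
  have hΛ0 : 0 < Λ := ha.trans_le haδ
  set l : ℝ := 1 + Real.log (1 + N) with hl
  have hl1 : 1 ≤ l := one_le_one_add_log (by linarith)
  set K := 1 + unionCoeff d / a with hK
  have hK0 : 0 ≤ K := by
    have := div_nonneg (unionCoeff_nonneg d) ha.le
    linarith
  set y := Real.log (2 * unionSize d N / δ) with hy
  -- The lower bound `a` on `Λ` turns the additive `log (2 * unionSize d N)` into a multiple of `Λ`.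
  have hyΛ : y ≤ Λ * K * l ^ 2 := by
    have hpos : (2 * unionSize d N : ℝ) ≠ 0 := by rw [unionSize]; positivity
    have h1 : y = Real.log (2 * unionSize d N) + Λ := by
      rw [hy, hΛ, div_eq_mul_one_div, Real.log_mul hpos (by positivity)]
    have h2 := log_two_mul_unionSize_le d N
    have h3 : unionCoeff d ≤ Λ * (unionCoeff d / a) := by
      rw [mul_div_assoc', le_div_iff₀ ha]
      nlinarith [unionCoeff_nonneg d]
    have h4 : Λ * K * l ≤ Λ * K * l ^ 2 := by
      refine mul_le_mul_of_nonneg_left ?_ (by positivity)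
      nlinarith
    have h5 : unionCoeff d * l ≤ Λ * (unionCoeff d / a) * l :=
      mul_le_mul_of_nonneg_right h3 (by linarith)
    have h6 : Λ ≤ Λ * l := le_mul_of_one_le_right hΛ0.le hl1
    have h7 : Λ * K * l = Λ * l + Λ * (unionCoeff d / a) * l := by rw [hK]; ring
    rw [← hl] at h2
    linarith
  have hsy : √y ≤ √Λ * √K * l := by
    calc √y ≤ √(Λ * K * l ^ 2) := Real.sqrt_le_sqrt hyΛ
      _ = _ := by
        rw [Real.sqrt_mul (by positivity), Real.sqrt_mul hΛ0.le, Real.sqrt_sq (by linarith)]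
  -- Likewise, terms without a `√Λ` acquire one at the price of `1 / √a`; hence the need for `δ`
  -- bounded away from `1`.
  have hone : 1 ≤ √Λ / √a := by
    rw [one_le_div (Real.sqrt_pos.2 ha)]
    exact Real.sqrt_le_sqrt haδ
  have hlq : 1 ≤ l ^ q := one_le_pow₀ hl1
  have hlq1 : l ^ q ≤ l ^ (q + 1) := pow_le_pow_right₀ hl1 (Nat.le_succ q)
  have hll : l ≤ l ^ (q + 1) := le_self_pow₀ hl1 (Nat.succ_ne_zero q)
  have hmain : 4 + 2 * √y + r * l ^ q ≤
      √Λ * (4 / √a + 2 * √K + |r| / √a) * l ^ (q + 1) := by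
    have h1 : 4 ≤ 4 * (√Λ / √a) * l ^ (q + 1) := by nlinarith
    have h2 : 2 * √y ≤ 2 * (√Λ * √K) * l ^ (q + 1) := by
      have := mul_le_mul_of_nonneg_left hll (by positivity : 0 ≤ √Λ * √K)
      linarith
    have h3 : r * l ^ q ≤ |r| * (√Λ / √a) * l ^ (q + 1) := by
      calc r * l ^ q ≤ |r| * l ^ q := mul_le_mul_of_nonneg_right (le_abs_self r) (by positivity)
        _ ≤ |r| * (√Λ / √a) * l ^ q :=
          mul_le_mul_of_nonneg_right (le_mul_of_one_le_right (abs_nonneg r) hone) (by positivity)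
        _ ≤ _ := mul_le_mul_of_nonneg_left hlq1 (by positivity)
    calc _ ≤ 4 * (√Λ / √a) * l ^ (q + 1) + 2 * (√Λ * √K) * l ^ (q + 1) +
          |r| * (√Λ / √a) * l ^ (q + 1) := by linarith
      _ = _ := by ring
  have hσ1 : 1 ≤ √(N : ℝ) := Real.one_le_sqrt.2 hN'
  have hσ : √(N : ℝ) * √N = N := Real.mul_self_sqrt (by linarith)
  have hrhs : √(order b T δ * l ^ (2 * (q + 1)) / N) = b * T * √Λ * l ^ (q + 1) / √N := by
    rw [Real.sqrt_div' _ (by linarith), order, ← hΛ,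
      show b ^ 2 * (T : ℝ) ^ 2 * Λ * l ^ (2 * (q + 1)) = (b * T * l ^ (q + 1)) ^ 2 * Λ by ring,
      Real.sqrt_mul (by positivity), Real.sqrt_sq (by positivity)]
    ring
  have hpoly : polylog r q N = r * l ^ q := rfl
  rw [hrhs, hpoly, Real.sqrt_mul (by linarith)]
  set σ := √(N : ℝ) with hσdef
  have hσ0 : 0 < σ := by linarith
  calc T * (4 * b + 2 * (b * (σ * √y)) + N * (b * (r * l ^ q) / σ)) / N
      = b * T / σ * (4 / σ + 2 * √y + r * l ^ q) := by
        rw [← hσ]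
        field_simp
    _ ≤ b * T / σ * (√Λ * (4 / √a + 2 * √K + |r| / √a) * l ^ (q + 1)) := by
        refine mul_le_mul_of_nonneg_left (le_trans ?_ hmain) (by positivity)
        have : 4 / σ ≤ 4 := div_le_self (by norm_num) hσ1
        linarith
    _ = _ := by ring

/-- Small regret suffices for success with high probability. -/
theorem exists_polylog_le_successProb (d k : ℕ) (c δ₀ : ℝ) (hc : 0 < c) (hδ₀ : δ₀ < 1) (r : ℝ)
    (q : ℕ) : ∃ (C : ℝ) (p : ℕ),
      ∀ {S A : Type*} (I : Problem S A d) (m N : ℕ) (L : I.Learner m) (b δ : ℝ),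
        0 < m → 0 < N → 0 < δ → δ ≤ δ₀ → I.IsLossBound b →
        L.RegretLE N (b * polylog r q N / √N) →
        order b I.T δ ≤ polylog c k (order b I.T δ) * N →
        ENNReal.ofReal (1 - δ) ≤ L.successProb N (polylog C p (order b I.T δ)) := by
  -- For `δ₀ ≤ 0` no `δ` is admissible and any constants do.
  obtain hδ₀0 | hδ₀0 := le_or_gt δ₀ 0
  · exact ⟨0, 0, fun I m N L b δ _ _ h1 h2 => absurd (h1.trans_le (h2.trans hδ₀0)) (lt_irrefl _)⟩
  have ha : 0 < Real.log (1 / δ₀) := Real.log_pos ((one_lt_div hδ₀0).2 hδ₀)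
  set a := Real.log (1 / δ₀)
  set K := 4 / √a + 2 * √(1 + unionCoeff d / a) + |r| / √a
  set n := 2 * (q + 1)
  set H := (c + 2) * (Real.exp 1 * n.factorial)
  have hK0 : 0 ≤ K := by positivity
  have hH0 : 0 ≤ H := by positivity
  refine ⟨K * √H, k + n, fun I m N L b δ hm hN hδ hδδ₀ hb hL hX => ?_⟩
  have haδ : a ≤ Real.log (1 / δ) :=
    Real.log_le_log (by positivity) (one_div_le_one_div_of_le hδ hδδ₀)
  have hX0 : 0 ≤ order b I.T δ := mul_nonneg (by positivity) (ha.le.trans haδ)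
  set X := order b I.T δ with hXdef
  have hl1 : 1 ≤ 1 + Real.log (1 + X) := one_le_one_add_log hX0
  have hp1 : 1 ≤ (1 + Real.log (1 + X)) ^ (k + n) := one_le_pow₀ hl1
  have hb0 : 0 ≤ b := hb.nonneg (L 0 Fin.elim0)
  obtain rfl | hb0 := hb0.eq_or_lt
  · rw [L.successProb_eq_one_of_bound_zero hb hN (by unfold polylog; positivity)]
    exact ENNReal.ofReal_le_one.2 (by linarith)
  refine (L.le_successProb hb hb0 hm hN hδ (hδδ₀.trans_lt hδ₀) hL).trans
    (L.successProb_mono ((excess_le hb0.le hN hδ ha haδ).trans ?_))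
  rw [polylog, mul_assoc]
  refine mul_le_mul_of_nonneg_left ?_ hK0
  calc √(X * (1 + Real.log (1 + N)) ^ n / N)
      ≤ √(H * (1 + Real.log (1 + X)) ^ (k + n)) := Real.sqrt_le_sqrt
        (mul_one_add_log_pow_div_le hX0 (by exact_mod_cast hN) hX n)
    _ = √H * √((1 + Real.log (1 + X)) ^ (k + n)) := Real.sqrt_mul hH0 _
    _ ≤ √H * (1 + Real.log (1 + X)) ^ (k + n) := by
        refine mul_le_mul_of_nonneg_left ?_ (Real.sqrt_nonneg _)
        rw [Real.sqrt_le_iff]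
        exact ⟨by linarith, by nlinarith⟩

lemma RegretLE.mono {S A : Type*} {d : ℕ} {I : Problem S A d} {m N : ℕ} {L : I.Learner m}
    {γ γ' : ℝ} (h : L.RegretLE N γ) (hγ : γ ≤ γ') : L.RegretLE N γ' :=
  fun D θ => (h D θ).trans (by linarith)

end Problem.Learner

end QDagger

theorem theorem2 (d k : ℕ) (c δ₀ : ℝ) (hc : 0 < c) (hδ₀ : δ₀ < 1) :
    -- an arbitrary convex surrogate and an arbitrary online learner with small regret
    (∀ (r : ℝ) (q : ℕ), ∃ (C : ℝ) (p : ℕ),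
      ∀ {S A : Type*} (I : QDagger.Problem S A d) (m N : ℕ) (L : I.Learner m) (b δ : ℝ),
        0 < m → 0 < N → 0 < δ → δ ≤ δ₀ → I.IsLossBound b →
        L.RegretLE N (b * QDagger.polylog r q N / √N) →
        QDagger.order b I.T δ ≤ QDagger.polylog c k (QDagger.order b I.T δ) * N →
        ENNReal.ofReal (1 - δ) ≤
          L.successProb N (QDagger.polylog C p (QDagger.order b I.T δ))) ∧
    -- follow-the-leader on the aggregated dataset, for a strongly convex Lipschitz surrogate
    (∀ (κ : ℝ) (G : NNReal), 0 < κ → ∃ (C : ℝ) (p : ℕ),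
      ∀ {S A : Type*} (I : QDagger.Problem S A d) (m N : ℕ) (L : I.Learner m) (b δ : ℝ),
        0 < m → 0 < N → 0 < δ → δ ≤ δ₀ → I.IsLossBound b →
        (∀ t < I.T, ∀ s, I.toMDP.weight I.oracle t s ≤ b) →
        (∀ s, StrongConvexOn I.params κ (I.surrogate s)) →
        (∀ s, LipschitzOnWith G (I.surrogate s) I.params) →
        L.IsFollowTheLeader →
        QDagger.order b I.T δ ≤ QDagger.polylog c k (QDagger.order b I.T δ) * N →
        ENNReal.ofReal (1 - δ) ≤
          L.successProb N (QDagger.polylog C p (QDagger.order b I.T δ))) := by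
  refine ⟨fun r q => QDagger.Problem.Learner.exists_polylog_le_successProb d k c δ₀ hc hδ₀ r q,
    fun κ G hκ => ?_⟩
  obtain ⟨C, p, h⟩ := QDagger.Problem.Learner.exists_polylog_le_successProb d k c δ₀ hc hδ₀
    (8 * G ^ 2 / κ) 1
  refine ⟨C, p, fun I m N L b δ hm hN hδ hδδ₀ hb hw hs hG hL hX =>
    h I m N L b δ hm hN hδ hδδ₀ hb ((hL.regretLE hm hκ hw hs hG N).mono ?_) hX⟩
  have hN' : (1 : ℝ) ≤ N := by exact_mod_cast hN
  have hb0 : 0 ≤ b := hb.nonneg (L 0 Fin.elim0)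
  -- Follow-the-leader has average regret of order `log N / N`, stronger than the required `log N /
  -- √N`.
  have hσ : √(N : ℝ) ≤ N := Real.sqrt_le_iff.2 ⟨by linarith, by nlinarith⟩
  have hlog : 0 ≤ Real.log (1 + (N : ℝ)) := Real.log_nonneg (by linarith)
  rw [QDagger.polylog, pow_one, inv_mul_eq_div]
  refine div_le_div₀ (by positivity) ?_ (by positivity) hσ
  have h0 : 0 ≤ 8 * (G : ℝ) ^ 2 / κ * b := by positivity
  nlinarith
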